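/- Let $c>0$ and $M\in\mathbb R$. There exist $\lambda,\eta>0$ and $\nu_*\in\mathbb R$, depending only on $c$ and $M$, with $\mathcal Re(\eta-\sqrt{-\nu_*})>0$ (principal complex square root), such that the following holds. Let $U:\mathbb R\to\mathbb R$ be $C^\infty$ with $|U''|\le M$ and $\int_{\mathbb R} e^{-U(x)}dx<\infty$, and assume that the probability measure $\mu_1\propto e^{-U(x)}dx$ satisfies the Poincaré inequality $\int |g'|^2d\mu_1\ge c\int g^2d\mu_1$ for every $C^1$ function $g$ with $g,g'\in L^2(\mu_1)$ and $\int g\,d\mu_1=0$. Let $\mu$ be the probability measure on $\mathbb R^2$ proportional to $e^{-U(x)}dx\otimes e^{-y^2/2}dy$, and let $(P_t)_{t\ge0}$ be the kinetic Fokker–Planck semigroup, i.e. the strongly continuous semigroup on (real) $L^2(\mu)$ whose infinitesimal generator, defined by $\mathcal Lf=\lim_{t\to0^+}(P_tf-f)/t$ in $L^2(\mu)$ whenever this limit exists, is the closure of $$L=y\,\partial_x-U'(x)\,\partial_y-y\,\partial_y+\partial_y^2$$ acting on $C_c^\infty(\mathbb R^2)$. Let $\mathcal D$ be any set of functions in the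 domain of $\mathcal L$ that is stable under $\mathcal L$ (for instance a core of $\mathcal L$ stable under $\mathcal L$), let $f\in\mathcal D$, write $\mu f=\int f\,d\mu$, and put $F_t=\|P_tf-\mu f\|_{L^2(\mu)}^2$ for $t\ge0$. (i) $F$ is $C^3$ on $[0,\infty)$ and there is a function $t\mapsto\nu_t$ on $[0,\infty)$ with $\nu_t\ge\nu_*$ for all $t\ge 0$, such that $[(\partial_t+\eta)^2+\nu_t]F_t$ is differentiable on $[0,\infty)$ and $$(\partial_t+\lambda)\big[(\partial_t+\eta)^2+\nu_t\big]F_t\le0\qquad\text{for all }t\ge0,$$ derivatives at $t=0$ being one-sided. (ii) Moreover $$\limsup_{t\to\infty}\frac1t\ln F_t\le-\min\big(\lambda,\ \mathcal Re(\eta-\sqrt{-\nu_*})\big),\qquad\text{with }\ln 0=-\infty.$$ -/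

import Mathlib

open MeasureTheory Set Filter Topology
open scoped ContDiff

noncomputable section

namespace KFP

/-- The position marginal at equilibrium: the probability measure proportional to `e^{-U(x)} dx`. -/
def positionMeasure (U : ℝ → ℝ) : Measure ℝ :=
  (volume : Measure ℝ).tilted (fun x => -U x)

/-- The invariant probability measure `μ`, proportional to `e^{-U(x)} dx ⊗ e^{-y²/2} dy`. -/
def gibbs (U : ℝ → ℝ) : Measure (ℝ × ℝ) :=
  (positionMeasure U).prod (ProbabilityTheory.gaussianReal 0 1)

/-- The Poincaré (spectral gap) inequality with constant `c` for a measure on the line. -/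
def Poincare (m : Measure ℝ) (c : ℝ) : Prop :=
  ∀ g : ℝ → ℝ, ContDiff ℝ 1 g → MemLp g 2 m → MemLp (deriv g) 2 m → ∫ z, g z ∂m = 0 →
    c * ∫ z, g z ^ 2 ∂m ≤ ∫ z, deriv g z ^ 2 ∂m

/-- The differential operator `L φ = y ∂ₓφ - U'(x) ∂_yφ - y ∂_yφ + ∂_y²φ`. -/
def diffOp (U : ℝ → ℝ) (φ : ℝ × ℝ → ℝ) : ℝ × ℝ → ℝ := fun z =>
  z.2 * deriv (fun x => φ (x, z.2)) z.1
    - deriv U z.1 * deriv (fun y => φ (z.1, y)) z.2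
    - z.2 * deriv (fun y => φ (z.1, y)) z.2
    + iteratedDeriv 2 (fun y => φ (z.1, y)) z.2

/-- The real Hilbert space `L²(μ)`. -/
abbrev L2 (U : ℝ → ℝ) : Type := Lp ℝ 2 (gibbs U)

/-- The graph, in `L²(μ) × L²(μ)`, of `L` restricted to smooth compactly supported functions. -/
def testGraph (U : ℝ → ℝ) : Set (L2 U × L2 U) :=
  {p | ∃ φ : ℝ × ℝ → ℝ, ContDiff ℝ ∞ φ ∧ HasCompactSupport φ ∧
    p.1 =ᵐ[gibbs U] φ ∧ p.2 =ᵐ[gibbs U] diffOp U φ}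

/-- Strongly continuous one-parameter semigroups of bounded operators, indexed by `t ≥ 0`
(the values of `P` at negative times play no role). -/
structure IsC0Semigroup {E : Type*} [NormedAddCommGroup E] [NormedSpace ℝ E]
    (P : ℝ → E →L[ℝ] E) : Prop where
  zero : P 0 = ContinuousLinearMap.id ℝ E
  add : ∀ s t : ℝ, 0 ≤ s → 0 ≤ t → P (s + t) = (P s).comp (P t)
  cont : ∀ f : E, ContinuousOn (fun t => P t f) (Ici 0)

/-- The graph of the infinitesimal generator: the pairs `(f, g)` with `(P_t f - f) / t → g`
as `t → 0⁺`. -/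
def generatorGraph {E : Type*} [NormedAddCommGroup E] [NormedSpace ℝ E]
    (P : ℝ → E →L[ℝ] E) : Set (E × E) :=
  {p | Tendsto (fun t : ℝ => t⁻¹ • (P t p.1 - p.1)) (𝓝[>] 0) (𝓝 p.2)}

/-- `P` is the kinetic Fokker–Planck semigroup on `L²(μ)`: the strongly continuous semigroup
whose infinitesimal generator is the closure of `L` on smooth compactly supported functions. -/
structure IsSemigroup (U : ℝ → ℝ) (P : ℝ → L2 U →L[ℝ] L2 U) : Prop where
  semigroup : IsC0Semigroup P
  generator : generatorGraph P = closure (testGraph U)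

/-- `F_t = ‖P_t f - μ f‖²` in `L²(μ)`. -/
def F (U : ℝ → ℝ) (P : ℝ → L2 U →L[ℝ] L2 U) (f : L2 U) (t : ℝ) : ℝ :=
  ∫ z, (P t f z - ∫ w, f w ∂(gibbs U)) ^ 2 ∂(gibbs U)

/-- The operator `∂_t + a` on functions of the time `t ≥ 0` (with a one-sided derivative at
`t = 0`). -/
def dPlus (a : ℝ) (φ : ℝ → ℝ) : ℝ → ℝ := fun t => derivWithin φ (Ici 0) t + a * φ t

/-- `Re (η - √(-ν))`, with the principal complex square root. -/
def rootRate (η ν : ℝ) : ℝ := ((η : ℂ) - Complex.sqrt (-(ν : ℂ))).re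

end KFP

end

namespace KFP
open ProbabilityTheory

/-! Only a lower bound on `ν` is required, so `ν` may be prescribed after the fact. It suffices to
find a function `G ≥ (∂ₜ + η)² F` with `(∂ₜ + λ) G ≤ 0`, and to put `ν = (G - (∂ₜ + η)² F) / F`.
Then `ν ≥ 0`, and `ν_* = 0` works, with root rate `η`.

Such a `G` comes from hypocoercivity. With `v` the first velocity moment of `h`, the energy `‖h -
μh‖²` dissipates only through `∂_y`. It is therefore modified by `-2ε⟨A h, h⟩`, where `A h = y φ(x)`
and `φ` solves `U'φ - φ' = r`, for `r` the centred velocity average of `h`. The flux identity `A L h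
= -y v(x)` (`phi_diffOp`) and an integration by parts (`integral_phi_mul_diffOp`) make the missing
`∫ r²` appear in the dissipation. The error terms are absorbed by the Gaussian Poincaré inequality
in velocity, the bound `c ∫ φ² ≤ ∫ r²` (`phi_bound_marginal`, dual to Poincaré in position), and a
bound on `∫ φ'²` depending only on `c` and `M` (`integral_sq_phi_deriv_le`). The outcome is
`dissipation`. It passes to the whole generator by closure, because `A` is bounded.

For small `ε` the modified energy is equivalent to the centred one, and it decays at rate `2ε/3`
along every orbit starting in the domain. As `F`, `F'` and `F''` involve only `P_t f`, `P_t Lf` and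
`P_t L²f`, a multiple of the sum of the three modified energies serves as `G`. If `F` vanishes at
some time, the orbit is stationary from then on and `G` vanishes too. The limsup bound follows
directly from the decay of the modified energy of `P_t f`. -/

theorem integrable_sub {α : Type*} [MeasurableSpace α] {μ : Measure α} {f g : α → ℝ}
    (hf : Integrable f μ) (hg : Integrable g μ) : Integrable (fun x => f x - g x) μ := hf.sub hg

/-! ### Gaussian calculus in the velocity variable. -/

theorem hasDerivAt_gaussianPDFReal (y : ℝ) :
    HasDerivAt (gaussianPDFReal 0 1) (-(y * gaussianPDFReal 0 1 y)) y := by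
  have e : gaussianPDFReal 0 1 = fun y : ℝ => (√(2 * Real.pi))⁻¹ * Real.exp (-y ^ 2 / 2) := by
    funext y; simp [gaussianPDFReal]
  rw [e]
  have h1 : HasDerivAt (fun y : ℝ => -y ^ 2 / 2) (-y) y := by
    have := ((hasDerivAt_pow 2 y).fun_neg).div_const 2
    refine this.congr_deriv ?_
    norm_num; ring
  refine (h1.exp.const_mul _).congr_deriv ?_
  ring

theorem continuous_gaussianPDFReal : Continuous (gaussianPDFReal 0 1) :=
  continuous_iff_continuousAt.2 fun y => (hasDerivAt_gaussianPDFReal y).continuousAt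

theorem integral_gaussian (f : ℝ → ℝ) :
    ∫ y, f y ∂(gaussianReal 0 1) = ∫ y, gaussianPDFReal 0 1 y * f y := by
  rw [integral_gaussianReal_eq_integral_smul one_ne_zero]; rfl

theorem integrable_gaussian_iff (f : ℝ → ℝ) :
    Integrable f (gaussianReal 0 1) ↔ Integrable fun y => gaussianPDFReal 0 1 y * f y := by
  rw [gaussianReal_of_var_ne_zero _ one_ne_zero, integrable_withDensity_iff_integrable_smul']
  · simp [toReal_gaussianPDF]
  · exact measurable_gaussianPDF 0 1
  · exact ae_of_all _ fun _ => gaussianPDF_lt_top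

/-- Integration by parts for the standard Gaussian measure. -/
theorem integral_deriv_gaussian_of_integrable {k k' : ℝ → ℝ} (hk : ∀ y, HasDerivAt k (k' y) y)
    (h1 : Integrable k (gaussianReal 0 1)) (h2 : Integrable k' (gaussianReal 0 1))
    (h3 : Integrable (fun y => y * k y) (gaussianReal 0 1)) :
    ∫ y, k' y ∂(gaussianReal 0 1) = ∫ y, y * k y ∂(gaussianReal 0 1) := by
  rw [integrable_gaussian_iff] at h1 h2 h3
  rw [integral_gaussian, integral_gaussian, ← sub_eq_zero, ← integral_sub h2 h3]
  refine integral_eq_zero_of_hasDerivAt_of_integrable (f := fun y => gaussianPDFReal 0 1 y * k y)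
    (fun y => ?_) (h2.sub h3) h1
  refine ((hasDerivAt_gaussianPDFReal y).fun_mul (hk y)).congr_deriv ?_
  ring

theorem integral_deriv_gaussian {k k' : ℝ → ℝ} (hk : ∀ y, HasDerivAt k (k' y) y)
    (hc : Continuous k') (hs : HasCompactSupport k) :
    ∫ y, k' y ∂(gaussianReal 0 1) = ∫ y, y * k y ∂(gaussianReal 0 1) := by
  have hkc : Continuous k := continuous_iff_continuousAt.2 fun y => (hk y).continuousAt
  have hs' : HasCompactSupport k' := by
    have : k' = deriv k := funext fun y => (hk y).deriv.symm
    rw [this]; exact hs.deriv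
  exact integral_deriv_gaussian_of_integrable hk (hkc.integrable_of_hasCompactSupport hs)
    (hc.integrable_of_hasCompactSupport hs')
    ((continuous_id.mul hkc).integrable_of_hasCompactSupport hs.mul_left)

theorem integral_id_gaussian : ∫ y, y ∂(gaussianReal 0 1) = 0 := by
  simp

theorem integral_sq_gaussian : ∫ y, y ^ 2 ∂(gaussianReal 0 1) = 1 := by
  have h := variance_id_gaussianReal (μ := 0) (v := 1)
  rw [variance_of_integral_eq_zero aemeasurable_id (by simp [integral_id_gaussianReal])] at h
  simpa using h

theorem integrable_pow_gaussian (n : ℕ) : Integrable (fun y : ℝ => y ^ n) (gaussianReal 0 1) := by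
  rcases Nat.eq_zero_or_pos n with rfl | hn
  · simp
  have h := (memLp_id_gaussianReal (μ := 0) (v := 1) (n : NNReal))
  have := h.integrable_norm_pow (by positivity)
  refine this.mono' (by fun_prop) (ae_of_all _ fun y => by simp)

theorem integral_pow_add_two_gaussian (n : ℕ) : ∫ y : ℝ, y ^ (n + 2) ∂(gaussianReal 0 1) =
    (n + 1) * ∫ y : ℝ, y ^ n ∂(gaussianReal 0 1) := by
  have h := integral_deriv_gaussian_of_integrable (k := fun y => y ^ (n + 1))
    (k' := fun y => (n + 1) * y ^ n) (fun y => by simpa using hasDerivAt_pow (n + 1) y)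
    (integrable_pow_gaussian _) ((integrable_pow_gaussian _).const_mul _)
    ((integrable_pow_gaussian (n + 2)).congr (ae_of_all _ fun y => by ring))
  rw [integral_const_mul] at h
  rw [h]
  exact integral_congr_ae (ae_of_all _ fun y => by ring)

/-- A Hardy-type argument with the first eigenfunction `y`: for `Q = p f² / y`, one has `Q' = p (f'²
- f² - (f' - f/y)²)`. Hence `Q'` is at most the integrand, and `Q` is nonnegative at `b` and
nonpositive at `-b`. -/
theorem hardy_gaussian_interval {f f' : ℝ → ℝ} (hf : ∀ y, HasDerivAt f (f' y) y)
    (hc : Continuous f') (h0 : f 0 = 0) {b : ℝ} (hb : 0 < b) :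
    0 ≤ ∫ y in (-b)..b, gaussianPDFReal 0 1 y * (f' y ^ 2 - f y ^ 2) := by
  have hfc : Continuous f := continuous_iff_continuousAt.2 fun y => (hf y).continuousAt
  set p := gaussianPDFReal 0 1 with hpdef
  have hp : Continuous p := continuous_gaussianPDFReal
  have hp0 : ∀ y, 0 ≤ p y := gaussianPDFReal_nonneg 0 1
  set Q : ℝ → ℝ := fun y => p y * (f y * dslope f 0 y) with hQ
  -- `dslope f 0` extends `f y / y` continuously through `0`, so the two half-intervals can be
  -- treated up to the singular point.
  have hds : Continuous (dslope f 0) := by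
    refine continuous_iff_continuousAt.2 fun y => ?_
    rcases eq_or_ne y 0 with rfl | hy
    · exact continuousAt_dslope_same.2 (hf 0).differentiableAt
    · exact (continuousAt_dslope_of_ne hy).2 hfc.continuousAt
  have hQc : Continuous Q := hp.mul (hfc.mul hds)
  have hdsv : ∀ y, y ≠ 0 → dslope f 0 y = f y / y := fun y hy => by
    rw [dslope_of_ne _ hy, slope_def_field, h0]; simp
  have hQd : ∀ y, y ≠ 0 → HasDerivAt Q
      (p y * (2 * f y * f' y / y - f y ^ 2 / y ^ 2 - f y ^ 2)) y := by
    intro y hy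
    have h1 : HasDerivAt (fun y => p y * (f y * (f y / y)))
        (p y * (2 * f y * f' y / y - f y ^ 2 / y ^ 2 - f y ^ 2)) y := by
      refine ((hasDerivAt_gaussianPDFReal y).fun_mul
        ((hf y).fun_mul ((hf y).fun_div (hasDerivAt_id y) hy))).congr_deriv ?_
      simp only [← hpdef, id]
      field_simp
      ring
    refine h1.congr_of_eventuallyEq ?_
    filter_upwards [isOpen_ne.mem_nhds hy] with z hz
    simp only [hQ, hdsv z hz]
  have hle : ∀ y, y ≠ 0 → p y * (2 * f y * f' y / y - f y ^ 2 / y ^ 2 - f y ^ 2) ≤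
      p y * (f' y ^ 2 - f y ^ 2) := by
    intro y hy
    refine mul_le_mul_of_nonneg_left ?_ (hp0 y)
    have : f' y ^ 2 - f y ^ 2 - (2 * f y * f' y / y - f y ^ 2 / y ^ 2 - f y ^ 2) =
      (f' y - f y / y) ^ 2 := by field_simp; ring
    nlinarith [sq_nonneg (f' y - f y / y)]
  have hφ : Continuous fun y => p y * (f' y ^ 2 - f y ^ 2) := by fun_prop
  have e1 := intervalIntegral.sub_le_integral_of_hasDeriv_right_of_le (a := 0) (b := b) hb.le
    hQc.continuousOn (fun y hy => (hQd y hy.1.ne').hasDerivWithinAt)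
    (hφ.integrableOn_Icc) (fun y hy => hle y hy.1.ne')
  have e2 := intervalIntegral.sub_le_integral_of_hasDeriv_right_of_le (a := -b) (b := 0)
    (by linarith)
    hQc.continuousOn (fun y hy => (hQd y hy.2.ne).hasDerivWithinAt)
    (hφ.integrableOn_Icc) (fun y hy => hle y hy.2.ne)
  have q1 : 0 ≤ Q b := by
    simp only [hQ, hdsv b hb.ne']
    have : f b * (f b / b) = f b ^ 2 / b := by ring
    rw [this]; have := hp0 b; positivity
  have q2 : Q (-b) ≤ 0 := by
    simp only [hQ, hdsv (-b) (by linarith)]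
    have : p (-b) * (f (-b) * (f (-b) / -b)) = -(p (-b) * (f (-b) ^ 2 / b)) := by field_simp
    rw [this]; have := hp0 (-b); simp; positivity
  rw [← intervalIntegral.integral_add_adjacent_intervals (hφ.intervalIntegrable (-b) 0)
    (hφ.intervalIntegrable 0 b)]
  linarith

/-- The Poincaré inequality for the standard Gaussian measure. -/
theorem poincare_gaussian {g g' : ℝ → ℝ} (hg : ∀ y, HasDerivAt g (g' y) y)
    (hc : Continuous g') (hs : HasCompactSupport g) :
    ∫ y, g y ^ 2 ∂(gaussianReal 0 1) - (∫ y, g y ∂(gaussianReal 0 1)) ^ 2 ≤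
      ∫ y, g' y ^ 2 ∂(gaussianReal 0 1) := by
  have hgc : Continuous g := continuous_iff_continuousAt.2 fun y => (hg y).continuousAt
  have hs' : HasCompactSupport g' := by
    have : g' = deriv g := funext fun y => (hg y).deriv.symm
    rw [this]; exact hs.deriv
  have i1 : Integrable g (gaussianReal 0 1) := hgc.integrable_of_hasCompactSupport hs
  have i2 : Integrable (fun y => g y ^ 2) (gaussianReal 0 1) :=
    (hgc.pow 2).integrable_of_hasCompactSupport (by simpa [pow_two] using hs.mul_left)
  have i3 : Integrable (fun y => g' y ^ 2) (gaussianReal 0 1) :=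
    (hc.pow 2).integrable_of_hasCompactSupport (by simpa [pow_two] using hs'.mul_left)
  have i4 : Integrable (fun y => (g y - g 0) ^ 2) (gaussianReal 0 1) := by
    have : (fun y => (g y - g 0) ^ 2) = fun y => g y ^ 2 - 2 * g 0 * g y + g 0 ^ 2 := by
      funext y; ring
    rw [this]
    exact (integrable_sub i2 (i1.const_mul _)).add (integrable_const _)
  have hE : ∫ y, (g y - g 0) ^ 2 ∂(gaussianReal 0 1) = ∫ y, g y ^ 2 ∂(gaussianReal 0 1)
      - 2 * g 0 * ∫ y, g y ∂(gaussianReal 0 1) + g 0 ^ 2 := by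
    have : (fun y => (g y - g 0) ^ 2) = fun y => g y ^ 2 - 2 * g 0 * g y + g 0 ^ 2 := by
      funext y; ring
    rw [this, integral_add (integrable_sub i2 (i1.const_mul _)) (integrable_const _),
      integral_sub i2 (i1.const_mul _), integral_const_mul]
    simp
  -- Subtracting `g 0` instead of the mean gives the vanishing at `0` that the Hardy argument needs.
  -- The second moment about `g 0` is at least the variance.
  have key : 0 ≤ ∫ y, (g' y ^ 2 - (g y - g 0) ^ 2) ∂(gaussianReal 0 1) := by
    have i5 : Integrable (fun y => g' y ^ 2 - (g y - g 0) ^ 2) (gaussianReal 0 1) := i3.sub i4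
    have i6 : Integrable (fun y => gaussianPDFReal 0 1 y * (g' y ^ 2 - (g y - g 0) ^ 2)) := by
      exact (integrable_gaussian_iff _).1 i5
    rw [integral_gaussian]
    refine ge_of_tendsto (intervalIntegral_tendsto_integral i6 tendsto_neg_atTop_atBot tendsto_id) ?_
    filter_upwards [eventually_gt_atTop 0] with b hb
    exact hardy_gaussian_interval (f := fun y => g y - g 0) (fun y => (hg y).sub_const _) hc
      (by simp) hb
  rw [integral_sub i3 i4, hE] at key
  nlinarith [sq_nonneg (g 0 - ∫ y, g y ∂(gaussianReal 0 1))]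

/-- Bessel's inequality for the first three Hermite polynomials. -/
theorem bessel_gaussian {g : ℝ → ℝ} (hgc : Continuous g) (hs : HasCompactSupport g) :
    (∫ y, g y ∂(gaussianReal 0 1)) ^ 2 + (∫ y, y * g y ∂(gaussianReal 0 1)) ^ 2 +
      (∫ y, (y ^ 2 - 1) * g y ∂(gaussianReal 0 1)) ^ 2 / 2 ≤
      ∫ y, g y ^ 2 ∂(gaussianReal 0 1) := by
  set γ := gaussianReal 0 1
  set u := ∫ y, g y ∂γ with hu
  set v := ∫ y, y * g y ∂γ with hv
  set w := ∫ y, (y ^ 2 - 1) * g y ∂γ with hw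
  have i1 : Integrable g γ := hgc.integrable_of_hasCompactSupport hs
  have i2 : Integrable (fun y => g y ^ 2) γ :=
    (hgc.pow 2).integrable_of_hasCompactSupport (by simpa [pow_two] using hs.mul_left)
  have i3 : Integrable (fun y => y * g y) γ :=
    (continuous_id.mul hgc).integrable_of_hasCompactSupport hs.mul_left
  have i4 : Integrable (fun y => (y ^ 2 - 1) * g y) γ :=
    (((continuous_id.pow 2).sub continuous_const).mul hgc).integrable_of_hasCompactSupport
      hs.mul_left
  have m1 : ∫ y, y ^ 1 ∂γ = 0 := by simpa only [pow_one] using integral_id_gaussian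
  have m2 : ∫ y, y ^ 2 ∂γ = 1 := integral_sq_gaussian
  have m3 : ∫ y, y ^ 3 ∂γ = 0 := by
    rw [integral_pow_add_two_gaussian 1, m1, mul_zero]
  have m4 : ∫ y, y ^ 4 ∂γ = 3 := by
    rw [integral_pow_add_two_gaussian 2, m2]; norm_num
  have P := integrable_pow_gaussian
  have hp : ∫ y, (u + v * y + w / 2 * (y ^ 2 - 1)) ^ 2 ∂γ = u ^ 2 + v ^ 2 + w ^ 2 / 2 := by
    have : (fun y : ℝ => (u + v * y + w / 2 * (y ^ 2 - 1)) ^ 2) = fun y =>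
        (u - w / 2) ^ 2 * y ^ 0 + 2 * (u - w / 2) * v * y ^ 1 + (v ^ 2 + (u - w / 2) * w) * y ^ 2
          + v * w * y ^ 3 + w ^ 2 / 4 * y ^ 4 := by funext y; ring
    rw [this, integral_add, integral_add, integral_add, integral_add, integral_const_mul,
      integral_const_mul, integral_const_mul, integral_const_mul, integral_const_mul,
      m1, m2, m3, m4]
    · simp; ring
    all_goals
      repeat' apply Integrable.add
      all_goals exact (P _).const_mul _
  have hg : ∫ y, g y * (u + v * y + w / 2 * (y ^ 2 - 1)) ∂γ = u ^ 2 + v ^ 2 + w ^ 2 / 2 := by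
    have : (fun y => g y * (u + v * y + w / 2 * (y ^ 2 - 1))) = fun y =>
        u * g y + v * (y * g y) + w / 2 * ((y ^ 2 - 1) * g y) := by funext y; ring
    rw [this, integral_add ((i1.const_mul _).fun_add (i3.const_mul _)) (i4.const_mul _),
      integral_add (i1.const_mul _) (i3.const_mul _), integral_const_mul, integral_const_mul,
      integral_const_mul, ← hu, ← hv, ← hw]
    ring
  have ip : Integrable (fun y : ℝ => (u + v * y + w / 2 * (y ^ 2 - 1)) ^ 2) γ := by
    have : (fun y : ℝ => (u + v * y + w / 2 * (y ^ 2 - 1)) ^ 2) = fun y =>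
        (u - w / 2) ^ 2 * y ^ 0 + 2 * (u - w / 2) * v * y ^ 1 + (v ^ 2 + (u - w / 2) * w) * y ^ 2
          + v * w * y ^ 3 + w ^ 2 / 4 * y ^ 4 := by funext y; ring
    rw [this]
    repeat' apply Integrable.add
    all_goals exact (P _).const_mul _
  have ig : Integrable (fun y => g y * (u + v * y + w / 2 * (y ^ 2 - 1))) γ :=
    (hgc.mul (by fun_prop)).integrable_of_hasCompactSupport hs.mul_right
  -- The square of `g` minus its projection; the coefficient `w / 2` reflects that `y² - 1` has
  -- squared norm `2`.
  have : 0 ≤ ∫ y, (g y ^ 2 - 2 * (g y * (u + v * y + w / 2 * (y ^ 2 - 1))) +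
      (u + v * y + w / 2 * (y ^ 2 - 1)) ^ 2) ∂γ := by
    refine integral_nonneg fun y => ?_
    have := sq_nonneg (g y - (u + v * y + w / 2 * (y ^ 2 - 1)))
    simp only [Pi.zero_apply]; nlinarith
  rw [integral_add (integrable_sub i2 (ig.const_mul _)) ip, integral_sub i2 (ig.const_mul _),
    integral_const_mul, hg, hp] at this
  linarith

/-! ### The corrector `φ` and its bound in `L²`. -/

instance gibbs_isProbabilityMeasure (U : ℝ → ℝ) [IsProbabilityMeasure (positionMeasure U)] :
    IsProbabilityMeasure (gibbs U) := by
  unfold gibbs; infer_instance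

/-- The partition function of the position marginal. -/
noncomputable def partition (U : ℝ → ℝ) : ℝ := ∫ x, Real.exp (-U x)

theorem partition_pos {U : ℝ → ℝ} (hI : Integrable fun x => Real.exp (-U x)) :
    0 < partition U := integral_exp_pos hI

theorem integral_position (U g : ℝ → ℝ) :
    ∫ x, g x ∂(positionMeasure U) = ∫ x, Real.exp (-U x) / partition U * g x := by
  rw [positionMeasure, integral_tilted]; rfl

theorem gibbs_fst_eq (U : ℝ → ℝ) (x : ℝ) : gibbs U {z | z.1 = x} = 0 := by
  have : {z : ℝ × ℝ | z.1 = x} = {x} ×ˢ univ := by ext z; simp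
  rw [this, gibbs, Measure.prod_prod]
  have : positionMeasure U {x} = 0 := tilted_absolutelyContinuous _ _ (by simp)
  simp [this]

/-- The integral of `H` over the half-plane to the left of `x`. -/
noncomputable def leftIntegral (U : ℝ → ℝ) (H : ℝ × ℝ → ℝ) (x : ℝ) : ℝ :=
  ∫ z in {z : ℝ × ℝ | z.1 ≤ x}, H z ∂(gibbs U)

theorem measurableSet_fst_le (x : ℝ) : MeasurableSet {z : ℝ × ℝ | z.1 ≤ x} :=
  measurableSet_le measurable_fst measurable_const

theorem leftIntegral_eq (U : ℝ → ℝ) (H : ℝ × ℝ → ℝ) (x : ℝ) :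
    leftIntegral U H x = ∫ z, {z : ℝ × ℝ | z.1 ≤ x}.indicator H z ∂(gibbs U) :=
  (integral_indicator (measurableSet_fst_le x)).symm

/-- Dominated convergence applies because vertical lines are null sets. -/
theorem continuous_leftIntegral (U : ℝ → ℝ) {H : ℝ × ℝ → ℝ} (hH : Integrable H (gibbs U)) :
    Continuous (leftIntegral U H) := by
  have : leftIntegral U H = fun x => ∫ z, {z : ℝ × ℝ | z.1 ≤ x}.indicator H z ∂(gibbs U) :=
    funext (leftIntegral_eq U H)
  rw [this, continuous_iff_continuousAt]
  intro x
  refine continuousAt_of_dominated (bound := fun z => ‖H z‖)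
    (Eventually.of_forall fun y => hH.aestronglyMeasurable.indicator (measurableSet_fst_le y))
    (Eventually.of_forall fun y => ae_of_all _ fun z => norm_indicator_le_norm_self _ _)
    hH.norm ?_
  have : ∀ᵐ z ∂(gibbs U), z.1 ≠ x := by
    rw [ae_iff]; simpa using gibbs_fst_eq U x
  filter_upwards [this] with z hz
  rcases lt_or_gt_of_ne hz with h | h
  · refine (continuousAt_const (y := H z)).congr ?_
    filter_upwards [lt_mem_nhds h] with y hy
    rw [indicator_of_mem]; exact hy.le
  · refine (continuousAt_const (y := (0 : ℝ))).congr ?_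
    filter_upwards [gt_mem_nhds h] with y hy
    rw [indicator_of_notMem]; simpa using hy

/-- The solution `φ` of `U'φ - φ' = h - μh`, averaged over velocities. -/
noncomputable def phi (U : ℝ → ℝ) (h : ℝ × ℝ → ℝ) (x : ℝ) : ℝ :=
  -(partition U * Real.exp (U x) * leftIntegral U (fun z => h z - ∫ w, h w ∂(gibbs U)) x)

theorem continuous_phi {U : ℝ → ℝ} (hU : Continuous U) [IsProbabilityMeasure (positionMeasure U)]
    {h : ℝ × ℝ → ℝ} (hh : Integrable h (gibbs U)) : Continuous (phi U h) := by
  have := continuous_leftIntegral U (integrable_sub hh (integrable_const (∫ w, h w ∂(gibbs U))))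
  unfold phi
  fun_prop

/-- Integration by parts carried out by Fubini, so that `H` needs no regularity. The zero mean of
`H` removes the boundary term. -/
theorem integral_mul_leftIntegral (U : ℝ → ℝ) [IsProbabilityMeasure (positionMeasure U)]
    {H : ℝ × ℝ → ℝ} (hH : Integrable H (gibbs U)) (h0 : ∫ z, H z ∂(gibbs U) = 0)
    {g : ℝ → ℝ} (hg : Continuous g) (hs : HasCompactSupport g) :
    ∫ x, g x * leftIntegral U H x = -∫ z, H z * (∫ t in (0 : ℝ)..z.1, g t) ∂(gibbs U) := by
  have gi : Integrable g := hg.integrable_of_hasCompactSupport hs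
  have e1 : ∀ x, g x * leftIntegral U H x =
      ∫ z, g x * {z : ℝ × ℝ | z.1 ≤ x}.indicator H z ∂(gibbs U) := fun x => by
    rw [leftIntegral_eq, integral_const_mul]
  simp_rw [e1]
  have hm : MeasurableSet {p : ℝ × (ℝ × ℝ) | p.2.1 ≤ p.1} :=
    measurableSet_le (by fun_prop) (by fun_prop)
  have hint : Integrable (Function.uncurry fun (x : ℝ) (z : ℝ × ℝ) =>
      g x * {z : ℝ × ℝ | z.1 ≤ x}.indicator H z) (volume.prod (gibbs U)) := by
    refine ((gi.mul_prod hH).indicator hm).congr (ae_of_all _ fun p => ?_)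
    simp only [Function.uncurry, indicator, mem_ofPred_eq]
    split_ifs <;> simp
  rw [integral_integral_swap hint]
  have e2 : ∀ z : ℝ × ℝ, ∫ x, g x * {z : ℝ × ℝ | z.1 ≤ x}.indicator H z =
      (∫ t in Ioi (0 : ℝ), g t) * H z - H z * ∫ t in (0 : ℝ)..z.1, g t := by
    intro z
    have : ∀ x, g x * {z : ℝ × ℝ | z.1 ≤ x}.indicator H z = H z * (Ici z.1).indicator g x := by
      intro x
      simp only [indicator, mem_ofPred_eq, mem_Ici]
      split_ifs
      · ring
      · simp
    simp_rw [this]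
    rw [integral_const_mul, integral_indicator measurableSet_Ici, integral_Ici_eq_integral_Ioi,
      ← intervalIntegral.integral_interval_add_Ioi (a := 0) (b := z.1) gi.integrableOn
        gi.integrableOn]
    ring
  simp_rw [e2]
  have hb : ∃ C, ∀ x, |∫ t in (0 : ℝ)..x, g t| ≤ C := by
    refine ⟨∫ t, ‖g t‖, fun x => ?_⟩
    rw [← Real.norm_eq_abs]
    refine (intervalIntegral.norm_integral_le_integral_norm_uIoc).trans ?_
    exact setIntegral_le_integral gi.norm (ae_of_all _ fun _ => norm_nonneg _)
  obtain ⟨C, hC⟩ := hb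
  have hcont : Continuous fun x => ∫ t in (0 : ℝ)..x, g t :=
    intervalIntegral.continuous_primitive (fun a b => hg.intervalIntegrable a b) 0
  have i2 : Integrable (fun z : ℝ × ℝ => H z * ∫ t in (0 : ℝ)..z.1, g t) (gibbs U) := by
    refine hH.mul_bdd (c := C) (hcont.comp continuous_fst).aestronglyMeasurable
      (ae_of_all _ fun z => hC z.1)
  rw [integral_sub (hH.const_mul _) i2, integral_const_mul, h0]
  simp

theorem map_fst_gibbs (U : ℝ → ℝ) [IsProbabilityMeasure (positionMeasure U)] (g : ℝ → ℝ) :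
    ∫ z, g z.1 ∂(gibbs U) = ∫ x, g x ∂(positionMeasure U) := by
  rw [gibbs, integral_fun_fst]
  simp

/-- Duality with Poincaré. Let `K` be the centred primitive of `χ φ`. Then `X = ∫ χ φ²` equals `∫ H
K`, and Young and Poincaré give `2c X ≤ ∫ H² + c² ∫ K² ≤ ∫ H² + c ∫ (χ φ)² ≤ ∫ H² + c X`. The cutoff
makes `K` bounded and `X` finite, so `c X` can be subtracted. -/
theorem phi_bound_cutoff {U : ℝ → ℝ} (hU : Continuous U)
    (hI : Integrable fun x => Real.exp (-U x)) [IsProbabilityMeasure (positionMeasure U)]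
    {c : ℝ} (hc : 0 < c) (hP : Poincare (positionMeasure U) c)
    {h : ℝ × ℝ → ℝ} (hh : MemLp h 2 (gibbs U)) {χ : ℝ → ℝ} (hχ : Continuous χ)
    (hχs : HasCompactSupport χ) (h0 : ∀ x, 0 ≤ χ x) (h1 : ∀ x, χ x ≤ 1) :
    c * ∫ x, χ x * phi U h x ^ 2 ∂(positionMeasure U) ≤
      ∫ z, (h z - ∫ w, h w ∂(gibbs U)) ^ 2 ∂(gibbs U) := by
  have hhi : Integrable h (gibbs U) := hh.integrable (by norm_num)
  set H : ℝ × ℝ → ℝ := fun z => h z - ∫ w, h w ∂(gibbs U) with hHdef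
  have hH2 : MemLp H 2 (gibbs U) := hh.sub (memLp_const _)
  have hHi : Integrable H (gibbs U) := hH2.integrable (by norm_num)
  have hH0 : ∫ z, H z ∂(gibbs U) = 0 := by
    rw [hHdef, integral_sub hhi (integrable_const _)]; simp
  have hφ : Continuous (phi U h) := continuous_phi hU hhi
  set g : ℝ → ℝ := fun x => χ x * phi U h x with hg
  have hgc : Continuous g := hχ.mul hφ
  have hgs : HasCompactSupport g := hχs.mul_right
  have gi : Integrable g := hgc.integrable_of_hasCompactSupport hgs
  set G : ℝ → ℝ := fun x => ∫ t in (0 : ℝ)..x, g t with hG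
  have hGd : ∀ x, HasDerivAt G (g x) x := fun x =>
    intervalIntegral.integral_hasDerivAt_right (hgc.intervalIntegrable _ _)
      (hgc.stronglyMeasurableAtFilter _ _) hgc.continuousAt
  have hGc : Continuous G := continuous_iff_continuousAt.2 fun x => (hGd x).continuousAt
  have hGb : ∀ x, ‖G x‖ ≤ ∫ t, ‖g t‖ := fun x =>
    (intervalIntegral.norm_integral_le_integral_norm_uIoc).trans
      (setIntegral_le_integral gi.norm (ae_of_all _ fun _ => norm_nonneg _))
  set m := ∫ x, G x ∂(positionMeasure U) with hm
  set K : ℝ → ℝ := fun x => G x - m with hK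
  have hKd : ∀ x, HasDerivAt K (g x) x := fun x => (hGd x).sub_const _
  have hKderiv : deriv K = g := funext fun x => (hKd x).deriv
  have hGL : MemLp G 2 (positionMeasure U) :=
    MemLp.of_bound hGc.aestronglyMeasurable _ (ae_of_all _ hGb)
  have hKL : MemLp K 2 (positionMeasure U) := hGL.sub (memLp_const _)
  obtain ⟨B, hB⟩ := hgs.exists_bound_of_continuous hgc
  have hgL : MemLp g 2 (positionMeasure U) :=
    MemLp.of_bound hgc.aestronglyMeasurable _ (ae_of_all _ hB)
  have hpo := hP K (contDiff_one_iff_deriv.2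
    ⟨fun x => (hKd x).differentiableAt, by rw [hKderiv]; exact hgc⟩) hKL (by rwa [hKderiv])
    (by rw [hK, integral_sub (hGL.integrable (by norm_num)) (integrable_const _)]; simp [← hm])
  rw [hKderiv] at hpo
  have hX : ∫ x, χ x * phi U h x ^ 2 ∂(positionMeasure U) =
      ∫ z, H z * K z.1 ∂(gibbs U) := by
    rw [integral_position]
    have : ∀ x, Real.exp (-U x) / partition U * (χ x * phi U h x ^ 2) =
        -(g x * leftIntegral U H x) := by
      intro x
      have hZ := (partition_pos hI).ne'
      simp only [hg]
      rw [pow_two]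
      nth_rewrite 2 [phi]
      rw [Real.exp_neg]
      field_simp
      simp [hHdef]
    simp_rw [this]
    rw [integral_neg, integral_mul_leftIntegral U hHi hH0 hgc hgs, neg_neg]
    have i1 : Integrable (fun z : ℝ × ℝ => H z * G z.1) (gibbs U) :=
      hHi.mul_bdd (hGc.comp continuous_fst).aestronglyMeasurable (ae_of_all _ fun z => hGb z.1)
    have : ∀ z : ℝ × ℝ, H z * K z.1 = H z * G z.1 - H z * m := fun z => by simp only [hK]; ring
    simp_rw [this]
    rw [integral_sub i1 (hHi.mul_const _), integral_mul_const, hH0]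
    simp [hG]
  have hgg : ∫ x, g x ^ 2 ∂(positionMeasure U) ≤ ∫ x, χ x * phi U h x ^ 2 ∂(positionMeasure U) := by
    refine integral_mono hgL.integrable_sq ?_ fun x => ?_
    · exact (hχ.mul (hφ.pow 2)).integrable_of_hasCompactSupport hχs.mul_right
    · simp only [hg]
      have : (χ x * phi U h x) ^ 2 = χ x * (χ x * phi U h x ^ 2) := by ring
      rw [this]
      have := h0 x
      exact mul_le_of_le_one_left (by positivity) (h1 x)
  have hKf : MemLp (fun z : ℝ × ℝ => K z.1) 2 (gibbs U) := by
    refine MemLp.of_bound ((hGc.sub continuous_const).comp continuous_fst).aestronglyMeasurable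
      ((∫ t, ‖g t‖) + ‖m‖) (ae_of_all _ fun z => ?_)
    exact (norm_sub_le _ _).trans (by gcongr; exact hGb _)
  have hY : 2 * c * ∫ z, H z * K z.1 ∂(gibbs U) ≤
      ∫ z, H z ^ 2 ∂(gibbs U) + c ^ 2 * ∫ x, K x ^ 2 ∂(positionMeasure U) := by
    rw [← map_fst_gibbs U (fun x => K x ^ 2), ← integral_const_mul, ← integral_const_mul,
      ← integral_add hH2.integrable_sq (hKf.integrable_sq.const_mul _)]
    refine integral_mono ((hH2.integrable_mul hKf).const_mul _)
      (hH2.integrable_sq.add (hKf.integrable_sq.const_mul _)) fun z => ?_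
    change 2 * c * (H z * K z.1) ≤ H z ^ 2 + c ^ 2 * K z.1 ^ 2
    nlinarith [sq_nonneg (H z - c * K z.1)]
  rw [← hX] at hY
  nlinarith

/-- `max 0 (1 - |x|/(n+1))`. -/
noncomputable def tent (n : ℕ) (x : ℝ) : ℝ := max 0 (1 - |x| / (n + 1))

theorem continuous_tent (n : ℕ) : Continuous (tent n) := by unfold tent; fun_prop

theorem hasCompactSupport_tent (n : ℕ) : HasCompactSupport (tent n) := by
  refine HasCompactSupport.intro (isCompact_Icc (a := -((n : ℝ) + 1)) (b := n + 1)) fun x hx => ?_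
  have hn : (0 : ℝ) < n + 1 := by positivity
  have : (n : ℝ) + 1 < |x| := by
    by_contra! h
    exact hx (abs_le.1 h)
  rw [tent, max_eq_left]
  have := (one_lt_div hn).2 this
  linarith

theorem tent_nonneg (n : ℕ) (x : ℝ) : 0 ≤ tent n x := le_max_left _ _

theorem tent_le_one (n : ℕ) (x : ℝ) : tent n x ≤ 1 := by
  have : 0 ≤ |x| / ((n : ℝ) + 1) := by positivity
  exact max_le zero_le_one (by linarith)

theorem tendsto_tent (x : ℝ) : Tendsto (fun n => tent n x) atTop (𝓝 1) := by
  have h : Tendsto (fun n : ℕ => max 0 (1 - |x| * (1 / ((n : ℝ) + 1)))) atTop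
      (𝓝 (max 0 (1 - |x| * 0))) :=
    tendsto_const_nhds.max
      (tendsto_const_nhds.sub (tendsto_one_div_add_atTop_nhds_zero_nat.const_mul _))
  simpa [tent, div_eq_mul_inv] using h

/-- The cutoff bound is uniform, so Fatou's lemma along the tents yields integrability and the
estimate together. -/
theorem phi_bound {U : ℝ → ℝ} (hU : Continuous U)
    (hI : Integrable fun x => Real.exp (-U x)) [IsProbabilityMeasure (positionMeasure U)]
    {c : ℝ} (hc : 0 < c) (hP : Poincare (positionMeasure U) c)
    {h : ℝ × ℝ → ℝ} (hh : MemLp h 2 (gibbs U)) :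
    Integrable (fun x => phi U h x ^ 2) (positionMeasure U) ∧
    c * ∫ x, phi U h x ^ 2 ∂(positionMeasure U) ≤
      ∫ z, (h z - ∫ w, h w ∂(gibbs U)) ^ 2 ∂(gibbs U) := by
  set V := ∫ z, (h z - ∫ w, h w ∂(gibbs U)) ^ 2 ∂(gibbs U) with hV
  have hV0 : 0 ≤ V := integral_nonneg fun _ => sq_nonneg _
  have hφ : Continuous (phi U h) := continuous_phi hU (hh.integrable (by norm_num))
  have hb : ∀ n, ∫⁻ x, ENNReal.ofReal (tent n x * phi U h x ^ 2) ∂(positionMeasure U) ≤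
      ENNReal.ofReal (V / c) := by
    intro n
    have := phi_bound_cutoff hU hI hc hP hh (continuous_tent n) (hasCompactSupport_tent n)
      (tent_nonneg n) (tent_le_one n)
    rw [← ofReal_integral_eq_lintegral_ofReal]
    · refine ENNReal.ofReal_le_ofReal ?_
      rw [le_div_iff₀ hc, mul_comm]; exact this
    · exact ((continuous_tent n).mul (hφ.pow 2)).integrable_of_hasCompactSupport
        (hasCompactSupport_tent n).mul_right
    · exact ae_of_all _ fun x => mul_nonneg (tent_nonneg n x) (sq_nonneg _)
  have hl : ∫⁻ x, ENNReal.ofReal (phi U h x ^ 2) ∂(positionMeasure U) ≤ ENNReal.ofReal (V / c) := by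
    have e : ∀ x, ENNReal.ofReal (phi U h x ^ 2) =
        liminf (fun n => ENNReal.ofReal (tent n x * phi U h x ^ 2)) atTop := by
      intro x
      refine (Tendsto.liminf_eq (ENNReal.tendsto_ofReal ?_)).symm
      simpa using (tendsto_tent x).mul_const (phi U h x ^ 2)
    simp_rw [e]
    refine (lintegral_liminf_le fun n => ?_).trans ?_
    · exact (((continuous_tent n).mul (hφ.pow 2)).measurable).ennreal_ofReal
    · exact (liminf_le_liminf (Eventually.of_forall hb)).trans (by simp)
  have hint : Integrable (fun x => phi U h x ^ 2) (positionMeasure U) := by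
    refine ⟨(hφ.pow 2).aestronglyMeasurable, ?_⟩
    rw [hasFiniteIntegral_iff_ofReal (ae_of_all _ fun x => sq_nonneg _)]
    exact hl.trans_lt ENNReal.ofReal_lt_top
  refine ⟨hint, ?_⟩
  rw [← ofReal_integral_eq_lintegral_ofReal hint (ae_of_all _ fun x => sq_nonneg _),
    ENNReal.ofReal_le_ofReal_iff (by positivity), le_div_iff₀ hc] at hl
  linarith

theorem phi_congr (U : ℝ → ℝ) {h k : ℝ × ℝ → ℝ} (e : h =ᵐ[gibbs U] k) : phi U h = phi U k := by
  funext x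
  unfold phi leftIntegral
  rw [integral_congr_ae e]
  congr 2
  refine integral_congr_ae (ae_restrict_of_ae ?_)
  filter_upwards [e] with z hz
  rw [hz]

theorem phi_add (U : ℝ → ℝ) [IsProbabilityMeasure (positionMeasure U)] {h k : ℝ × ℝ → ℝ}
    (hh : Integrable h (gibbs U)) (hk : Integrable k (gibbs U)) :
    phi U (h + k) = phi U h + phi U k := by
  funext x
  have e : (fun z => (h + k) z - ∫ w, (h + k) w ∂(gibbs U)) = fun z =>
      (h z - ∫ w, h w ∂(gibbs U)) + (k z - ∫ w, k w ∂(gibbs U)) := by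
    funext z
    simp only [Pi.add_apply]
    rw [integral_add hh hk]; ring
  rw [Pi.add_apply]
  unfold phi leftIntegral
  rw [e]
  rw [integral_add (integrable_sub hh (integrable_const _)).integrableOn
    (integrable_sub hk (integrable_const _)).integrableOn]
  ring

theorem phi_smul (U : ℝ → ℝ) (a : ℝ) (h : ℝ × ℝ → ℝ) :
    phi U (a • h) = a • phi U h := by
  funext x
  have e : (fun z => (a • h) z - ∫ w, (a • h) w ∂(gibbs U)) = fun z =>
      a * (h z - ∫ w, h w ∂(gibbs U)) := by
    funext z
    simp only [Pi.smul_apply, smul_eq_mul, integral_const_mul]; ring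
  rw [Pi.smul_apply]
  unfold phi leftIntegral
  rw [e, integral_const_mul, smul_eq_mul]
  ring

/-! ### The Hilbert space `L²(μ)` and the correction operator. -/

theorem integral_mul_gibbs (U f g : ℝ → ℝ) [IsProbabilityMeasure (positionMeasure U)] :
    ∫ z, f z.1 * g z.2 ∂(gibbs U) =
      (∫ x, f x ∂(positionMeasure U)) * ∫ y, g y ∂(gaussianReal 0 1) :=
  integral_prod_mul f g

theorem memLp_mul_phi {U : ℝ → ℝ} (hU : Continuous U)
    (hI : Integrable fun x => Real.exp (-U x)) [IsProbabilityMeasure (positionMeasure U)]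
    {c : ℝ} (hc : 0 < c) (hP : Poincare (positionMeasure U) c)
    {h : ℝ × ℝ → ℝ} (hh : MemLp h 2 (gibbs U)) :
    MemLp (fun z => phi U h z.1 * z.2) 2 (gibbs U) := by
  have hφ : Continuous (phi U h) := continuous_phi hU (hh.integrable (by norm_num))
  rw [memLp_two_iff_integrable_sq
    (by fun_prop : Continuous fun z : ℝ × ℝ => phi U h z.1 * z.2).aestronglyMeasurable]
  simp_rw [mul_pow]
  exact (phi_bound hU hI hc hP hh).1.mul_prod (integrable_pow_gaussian 2)

theorem norm_sq_eq_integral {U : ℝ → ℝ} (k : L2 U) : ‖k‖ ^ 2 = ∫ z, k z ^ 2 ∂(gibbs U) := by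
  rw [← real_inner_self_eq_norm_sq, L2.inner_def]
  refine integral_congr_ae (ae_of_all _ fun z => ?_)
  simp [pow_two]

theorem inner_eq_integral {U : ℝ → ℝ} {h k : L2 U} {f g : ℝ × ℝ → ℝ} (hf : h =ᵐ[gibbs U] f)
    (hg : k =ᵐ[gibbs U] g) : inner ℝ h k = ∫ z, f z * g z ∂(gibbs U) := by
  rw [L2.inner_def]
  refine integral_congr_ae ?_
  filter_upwards [hf, hg] with z h1 h2
  rw [h1, h2]
  simp [mul_comm]

/-- The constant function `1` in `L²(μ)`. -/
noncomputable def one (U : ℝ → ℝ) [IsProbabilityMeasure (positionMeasure U)] : L2 U :=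
  (memLp_const (1 : ℝ) : MemLp (fun _ => (1 : ℝ)) 2 (gibbs U)).toLp _

theorem coeFn_one (U : ℝ → ℝ) [IsProbabilityMeasure (positionMeasure U)] :
    one U =ᵐ[gibbs U] fun _ => 1 := MemLp.coeFn_toLp _

theorem inner_one (U : ℝ → ℝ) [IsProbabilityMeasure (positionMeasure U)] (h : L2 U) :
    inner ℝ (one U) h = ∫ z, h z ∂(gibbs U) := by
  rw [inner_eq_integral (coeFn_one U) (ae_eq_refl _)]
  simp

theorem norm_one (U : ℝ → ℝ) [IsProbabilityMeasure (positionMeasure U)] : ‖one U‖ = 1 := by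
  have : ‖one U‖ ^ 2 = 1 := by
    rw [← real_inner_self_eq_norm_sq, inner_eq_integral (coeFn_one U) (coeFn_one U)]
    simp
  nlinarith [norm_nonneg (one U)]

theorem integral_sub_sq {U : ℝ → ℝ} [IsProbabilityMeasure (positionMeasure U)] (h : L2 U) (m : ℝ) :
    ∫ z, (h z - m) ^ 2 ∂(gibbs U) = ‖h - m • one U‖ ^ 2 := by
  rw [norm_sq_eq_integral]
  refine integral_congr_ae ?_
  filter_upwards [Lp.coeFn_sub h (m • one U), Lp.coeFn_smul m (one U), coeFn_one U] with z h1 h2 h3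
  rw [h1, Pi.sub_apply, h2, Pi.smul_apply, h3]
  simp

theorem norm_sub_inner_smul_sq {E : Type*} [NormedAddCommGroup E] [InnerProductSpace ℝ E]
    {e : E} (he : ‖e‖ = 1) (h : E) :
    ‖h - (inner ℝ e h : ℝ) • e‖ ^ 2 = ‖h‖ ^ 2 - (inner ℝ e h : ℝ) ^ 2 := by
  rw [norm_sub_sq_real, inner_smul_right, norm_smul, he, real_inner_comm]
  simp only [mul_one, Real.norm_eq_abs, sq_abs]
  ring

theorem norm_sq_le_of_eq_phi {U : ℝ → ℝ} (hU : Continuous U)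
    (hI : Integrable fun x => Real.exp (-U x)) [IsProbabilityMeasure (positionMeasure U)]
    {c : ℝ} (hc : 0 < c) (hP : Poincare (positionMeasure U) c) {h k : L2 U}
    (hk : k =ᵐ[gibbs U] fun z => phi U h z.1 * z.2) :
    ‖k‖ ^ 2 ≤ c⁻¹ * ‖h - (inner ℝ (one U) h : ℝ) • one U‖ ^ 2 := by
  have h1 : ‖k‖ ^ 2 = ∫ x, phi U h x ^ 2 ∂(positionMeasure U) := by
    rw [norm_sq_eq_integral]
    have : (fun z => k z ^ 2) =ᵐ[gibbs U] fun z => phi U h z.1 ^ 2 * z.2 ^ 2 := by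
      filter_upwards [hk] with z hz
      rw [← mul_pow, ← hz]
    rw [integral_congr_ae this, integral_mul_gibbs U (fun x => phi U h x ^ 2) (fun y => y ^ 2),
      integral_sq_gaussian, mul_one]
  have h2 := (phi_bound hU hI hc hP (Lp.memLp h)).2
  rw [integral_sub_sq, ← inner_one, ← h1] at h2
  rw [inv_mul_eq_div, le_div_iff₀ hc]; linarith

theorem le_sqrt_mul_of_sq_le {a b c : ℝ} (hb : 0 ≤ b) (hc : 0 ≤ c)
    (h : a ^ 2 ≤ c * b ^ 2) : a ≤ Real.sqrt c * b := by
  refine (Real.le_sqrt_of_sq_le h).trans_eq ?_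
  rw [Real.sqrt_mul hc, Real.sqrt_sq hb]

/-- The correction operator `h ↦ y φ_h(x)` of the modified energy. -/
theorem exists_correction {U : ℝ → ℝ} (hU : Continuous U)
    (hI : Integrable fun x => Real.exp (-U x)) [IsProbabilityMeasure (positionMeasure U)]
    {c : ℝ} (hc : 0 < c) (hP : Poincare (positionMeasure U) c) :
    ∃ A : L2 U →L[ℝ] L2 U, ∀ h : L2 U, A h =ᵐ[gibbs U] fun z => phi U h z.1 * z.2 := by
  let A₀ : L2 U →ₗ[ℝ] L2 U :=
    { toFun := fun h => (memLp_mul_phi hU hI hc hP (Lp.memLp h)).toLp _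
      map_add' := fun h k => by
        rw [← MemLp.toLp_add]
        refine MemLp.toLp_congr _ _ (ae_of_all _ fun z => ?_)
        rw [phi_congr U (Lp.coeFn_add h k), phi_add U ((Lp.memLp h).integrable (by norm_num))
          ((Lp.memLp k).integrable (by norm_num))]
        simp only [Pi.add_apply]; ring
      map_smul' := fun a h => by
        simp only [RingHom.id_apply]
        rw [← MemLp.toLp_const_smul]
        refine MemLp.toLp_congr _ _ (ae_of_all _ fun z => ?_)
        rw [phi_congr U (Lp.coeFn_smul a h), phi_smul]
        simp only [Pi.smul_apply, smul_eq_mul]; ring }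
  have hA₀ : ∀ h : L2 U, A₀ h =ᵐ[gibbs U] fun z => phi U h z.1 * z.2 := fun h =>
    MemLp.coeFn_toLp (memLp_mul_phi hU hI hc hP (Lp.memLp h))
  refine ⟨A₀.mkContinuous (Real.sqrt c⁻¹) fun h => ?_, hA₀⟩
  refine le_sqrt_mul_of_sq_le (norm_nonneg _) (by positivity)
    ((norm_sq_le_of_eq_phi hU hI hc hP (hA₀ h)).trans ?_)
  rw [norm_sub_inner_smul_sq (norm_one U)]
  have := inv_pos.2 hc
  gcongr
  nlinarith [sq_nonneg (inner ℝ (one U) h : ℝ)]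

/-- The range of `A` is orthogonal to constants, since `y` has zero mean, and `‖A h‖` is controlled
by the centred part of `h`. Both factors thus see only the centred part, which makes the modified
energy comparable to the centred one. -/
theorem correction_bounds {U : ℝ → ℝ} (hU : Continuous U)
    (hI : Integrable fun x => Real.exp (-U x)) [IsProbabilityMeasure (positionMeasure U)]
    {c : ℝ} (hc : 0 < c) (hP : Poincare (positionMeasure U) c) {A : L2 U →L[ℝ] L2 U}
    (hA : ∀ h : L2 U, A h =ᵐ[gibbs U] fun z => phi U h z.1 * z.2) (h : L2 U) :
    |inner ℝ (A h) h| ≤ Real.sqrt c⁻¹ * ‖h - (inner ℝ (one U) h : ℝ) • one U‖ ^ 2 := by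
  have h3 : inner ℝ (A h) (one U) = 0 := by
    rw [inner_eq_integral (hA h) (coeFn_one U)]
    have := integral_mul_gibbs U (phi U h) (fun y => y)
    rw [integral_id_gaussian, mul_zero] at this
    simpa using this
  set k := h - (inner ℝ (one U) h : ℝ) • one U with hk
  have h4 : inner ℝ (A h) h = inner ℝ (A h) k := by
    rw [hk, inner_sub_right, inner_smul_right, h3]; simp
  have h5 : ‖A h‖ ≤ Real.sqrt c⁻¹ * ‖k‖ :=
    le_sqrt_mul_of_sq_le (norm_nonneg _) (by positivity) (norm_sq_le_of_eq_phi hU hI hc hP (hA h))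
  rw [h4]
  refine (abs_real_inner_le_norm _ _).trans ?_
  calc ‖A h‖ * ‖k‖ ≤ (Real.sqrt c⁻¹ * ‖k‖) * ‖k‖ := by gcongr
    _ = _ := by ring

/-! ### Integration by parts for the transport operator on test functions. -/

/-- The partial derivative in the position variable. -/
noncomputable def dx (k : ℝ × ℝ → ℝ) (z : ℝ × ℝ) : ℝ := fderiv ℝ k z (1, 0)

/-- The partial derivative in the velocity variable. -/
noncomputable def dy (k : ℝ × ℝ → ℝ) (z : ℝ × ℝ) : ℝ := fderiv ℝ k z (0, 1)

theorem hasDerivAt_dx {k : ℝ × ℝ → ℝ} (hk : ContDiff ℝ 1 k) (x y : ℝ) :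
    HasDerivAt (fun x => k (x, y)) (dx k (x, y)) x :=
  ((hk.differentiable (by norm_num)) (x, y)).hasFDerivAt.comp_hasDerivAt x
    ((hasDerivAt_id x).prodMk (hasDerivAt_const x y))

theorem hasDerivAt_dy {k : ℝ × ℝ → ℝ} (hk : ContDiff ℝ 1 k) (x y : ℝ) :
    HasDerivAt (fun y => k (x, y)) (dy k (x, y)) y :=
  ((hk.differentiable (by norm_num)) (x, y)).hasFDerivAt.comp_hasDerivAt y
    ((hasDerivAt_const y x).prodMk (hasDerivAt_id y))

theorem continuous_dx {k : ℝ × ℝ → ℝ} (hk : ContDiff ℝ 1 k) : Continuous (dx k) :=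
  (hk.continuous_fderiv (by norm_num)).clm_apply continuous_const

theorem continuous_dy {k : ℝ × ℝ → ℝ} (hk : ContDiff ℝ 1 k) : Continuous (dy k) :=
  (hk.continuous_fderiv (by norm_num)).clm_apply continuous_const

theorem hasCompactSupport_dx {k : ℝ × ℝ → ℝ} (hs : HasCompactSupport k) :
    HasCompactSupport (dx k) := hs.fderiv_apply (𝕜 := ℝ) _

theorem hasCompactSupport_dy {k : ℝ × ℝ → ℝ} (hs : HasCompactSupport k) :
    HasCompactSupport (dy k) := hs.fderiv_apply (𝕜 := ℝ) _

theorem contDiff_dy {k : ℝ × ℝ → ℝ} (hk : ContDiff ℝ ∞ k) : ContDiff ℝ ∞ (dy k) :=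
  (hk.fderiv_right (m := ∞) (by norm_cast)).clm_apply contDiff_const

theorem diffOp_eq (U : ℝ → ℝ) {k : ℝ × ℝ → ℝ} (hk : ContDiff ℝ ∞ k) (z : ℝ × ℝ) :
    diffOp U k z = z.2 * dx k z - deriv U z.1 * dy k z - z.2 * dy k z + dy (dy k) z := by
  have h1 : ContDiff ℝ 1 k := hk.of_le (by norm_cast)
  have h2 : ContDiff ℝ 1 (dy k) := (contDiff_dy hk).of_le (by norm_cast)
  have e : deriv (fun y => k (z.1, y)) = fun y => dy k (z.1, y) :=
    funext fun y => (hasDerivAt_dy h1 z.1 y).deriv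
  rw [diffOp, iteratedDeriv_succ, iteratedDeriv_one, e, (hasDerivAt_dx h1 z.1 z.2).deriv,
    (hasDerivAt_dy h2 z.1 z.2).deriv]

theorem hasCompactSupport_right {k : ℝ × ℝ → ℝ} (hs : HasCompactSupport k) (x : ℝ) :
    HasCompactSupport fun y => k (x, y) := by
  refine HasCompactSupport.intro (hs.isCompact.image continuous_snd) fun y hy => ?_
  by_contra h
  exact hy ⟨(x, y), subset_tsupport _ h, rfl⟩

theorem hasCompactSupport_left {k : ℝ × ℝ → ℝ} (hs : HasCompactSupport k) (y : ℝ) :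
    HasCompactSupport fun x => k (x, y) := by
  refine HasCompactSupport.intro (hs.isCompact.image continuous_fst) fun x hx => ?_
  by_contra h
  exact hx ⟨(x, y), subset_tsupport _ h, rfl⟩

theorem hasCompactSupport_integral {k : ℝ × ℝ → ℝ} (hs : HasCompactSupport k) :
    HasCompactSupport fun x => ∫ y, k (x, y) ∂(gaussianReal 0 1) := by
  refine HasCompactSupport.intro (hs.isCompact.image continuous_fst) fun x hx => ?_
  have : ∀ y, k (x, y) = 0 := fun y => by
    by_contra h
    exact hx ⟨(x, y), subset_tsupport _ h, rfl⟩
  simp [this]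

theorem continuous_integral {k : ℝ × ℝ → ℝ} (hk : Continuous k) (hs : HasCompactSupport k) :
    Continuous fun x => ∫ y, k (x, y) ∂(gaussianReal 0 1) := by
  obtain ⟨C, hC⟩ := hs.exists_bound_of_continuous hk
  exact continuous_of_dominated (F := fun x y => k (x, y)) (bound := fun _ => C)
    (fun x => (by fun_prop : Continuous fun y => k (x, y)).aestronglyMeasurable)
    (fun x => ae_of_all _ fun y => hC _) (integrable_const _)
    (ae_of_all _ fun y => by fun_prop)

theorem integrable_right {k : ℝ × ℝ → ℝ} (hk : Continuous k) (hs : HasCompactSupport k) (x : ℝ) :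
    Integrable (fun y => k (x, y)) (gaussianReal 0 1) :=
  (by fun_prop : Continuous fun y => k (x, y)).integrable_of_hasCompactSupport
    (hasCompactSupport_right hs x)

theorem gibbs_restrict (U : ℝ → ℝ) [IsProbabilityMeasure (positionMeasure U)] (S : Set ℝ) :
    (gibbs U).restrict {z | z.1 ∈ S} = ((positionMeasure U).restrict S).prod (gaussianReal 0 1) := by
  have : {z : ℝ × ℝ | z.1 ∈ S} = S ×ˢ univ := by ext z; simp
  rw [this, gibbs, ← Measure.prod_restrict, Measure.restrict_univ]

theorem integral_gibbs_restrict (U : ℝ → ℝ) [IsProbabilityMeasure (positionMeasure U)] (S : Set ℝ)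
    {k : ℝ × ℝ → ℝ} (hk : Continuous k) (hs : HasCompactSupport k) :
    ∫ z in {z | z.1 ∈ S}, k z ∂(gibbs U) =
      ∫ x in S, ∫ y, k (x, y) ∂(gaussianReal 0 1) ∂(positionMeasure U) := by
  rw [gibbs_restrict, integral_prod _ (hk.integrable_of_hasCompactSupport hs)]

theorem integral_gibbs (U : ℝ → ℝ) [IsProbabilityMeasure (positionMeasure U)]
    {k : ℝ × ℝ → ℝ} (hk : Continuous k) (hs : HasCompactSupport k) :
    ∫ z, k z ∂(gibbs U) = ∫ x, ∫ y, k (x, y) ∂(gaussianReal 0 1) ∂(positionMeasure U) := by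
  simpa using integral_gibbs_restrict U univ hk hs

/-- The Hamiltonian part of the generator, integrated over a strip of positions. -/
theorem integral_transport {U : ℝ → ℝ} (hU : ContDiff ℝ ∞ U)
    [IsProbabilityMeasure (positionMeasure U)] (S : Set ℝ) {k : ℝ × ℝ → ℝ}
    (hk : ContDiff ℝ 1 k) (hs : HasCompactSupport k) {β : ℝ → ℝ}
    (hβ : ∀ y, ∫ x in S, (dx k (x, y) - deriv U x * k (x, y)) ∂(positionMeasure U) = β y) :
    ∫ z in {z | z.1 ∈ S}, (z.2 * dx k z - deriv U z.1 * dy k z) ∂(gibbs U) =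
      ∫ y, y * β y ∂(gaussianReal 0 1) := by
  have hU' : Continuous (deriv U) := hU.continuous_deriv (by norm_cast)
  have hkc := hk.continuous
  have hx := continuous_dx hk
  have hy := continuous_dy hk
  have sx := hasCompactSupport_dx hs
  have sy := hasCompactSupport_dy hs
  have c1 : Continuous fun z : ℝ × ℝ => z.2 * dx k z - deriv U z.1 * dy k z := by fun_prop
  have s1 : HasCompactSupport fun z : ℝ × ℝ => z.2 * dx k z - deriv U z.1 * dy k z :=
    sx.mul_left.sub sy.mul_left
  have c2 : Continuous fun z : ℝ × ℝ => z.2 * (dx k z - deriv U z.1 * k z) := by fun_prop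
  have s2 : HasCompactSupport fun z : ℝ × ℝ => z.2 * (dx k z - deriv U z.1 * k z) :=
    HasCompactSupport.mul_left (sx.sub hs.mul_left)
  rw [integral_gibbs_restrict U S c1 s1]
  -- Gaussian integration by parts trades `∂_y k` for `y k`. The factor `y` then comes out, leaving
  -- the position divergence `∂ₓk - U' k` to be integrated first.
  have e : ∀ x, ∫ y, (y * dx k (x, y) - deriv U x * dy k (x, y)) ∂(gaussianReal 0 1) =
      ∫ y, y * (dx k (x, y) - deriv U x * k (x, y)) ∂(gaussianReal 0 1) := by
    intro x
    have i1 : Integrable (fun y => y * dx k (x, y)) (gaussianReal 0 1) :=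
      integrable_right (k := fun z => z.2 * dx k z) (by fun_prop) sx.mul_left x
    have i2 : Integrable (fun y => y * k (x, y)) (gaussianReal 0 1) :=
      integrable_right (k := fun z => z.2 * k z) (by fun_prop) hs.mul_left x
    have ibp := integral_deriv_gaussian (fun y => hasDerivAt_dy hk x y) (by fun_prop)
      (hasCompactSupport_right hs x)
    rw [integral_sub i1 ((integrable_right hy sy x).const_mul _), integral_const_mul, ibp,
      ← integral_const_mul, ← integral_sub i1 (i2.const_mul _)]
    exact integral_congr_ae (ae_of_all _ fun y => by ring)
  simp_rw [e]
  rw [integral_integral_swap]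
  · simp_rw [integral_const_mul, hβ]
  · exact c2.integrable_of_hasCompactSupport s2

theorem hasDerivAt_density {U : ℝ → ℝ} (hU : ContDiff ℝ ∞ U) (x : ℝ) :
    HasDerivAt (fun x => Real.exp (-U x) / partition U)
      (-(deriv U x * (Real.exp (-U x) / partition U))) x := by
  have h : HasDerivAt U (deriv U x) x := (hU.differentiable (by simp) x).hasDerivAt
  refine (h.fun_neg.exp.div_const _).congr_deriv ?_
  ring

theorem setIntegral_position (U g : ℝ → ℝ) (S : Set ℝ) :
    ∫ x in S, g x ∂(positionMeasure U) = ∫ x in S, Real.exp (-U x) / partition U * g x := by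
  rw [positionMeasure, setIntegral_tilted]; rfl

theorem integral_Iic_position {U : ℝ → ℝ} (hU : ContDiff ℝ ∞ U) {j j' : ℝ → ℝ}
    (hj : ∀ x, HasDerivAt j (j' x) x) (hc : Continuous j') (hs : HasCompactSupport j) (a : ℝ) :
    ∫ x in Iic a, (j' x - deriv U x * j x) ∂(positionMeasure U) =
      Real.exp (-U a) / partition U * j a := by
  have hjc : Continuous j := continuous_iff_continuousAt.2 fun x => (hj x).continuousAt
  have hU' : Continuous (deriv U) := hU.continuous_deriv (by norm_cast)
  have hUc := hU.continuous
  have hd : ∀ x, HasDerivAt (fun x => Real.exp (-U x) / partition U * j x)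
      (Real.exp (-U x) / partition U * (j' x - deriv U x * j x)) x := fun x => by
    refine ((hasDerivAt_density hU x).fun_mul (hj x)).congr_deriv ?_
    ring
  have hde : deriv (fun x => Real.exp (-U x) / partition U * j x) = fun x =>
      Real.exp (-U x) / partition U * (j' x - deriv U x * j x) := funext fun x => (hd x).deriv
  rw [setIntegral_position]
  have := HasCompactSupport.integral_Iic_deriv_eq
    (f := fun x => Real.exp (-U x) / partition U * j x)
    (contDiff_one_iff_deriv.2 ⟨fun x => (hd x).differentiableAt, by rw [hde]; fun_prop⟩)
    hs.mul_left a
  rw [hde] at this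
  exact this

theorem integral_position_ibp {U : ℝ → ℝ} (hU : ContDiff ℝ ∞ U) {j j' : ℝ → ℝ}
    (hj : ∀ x, HasDerivAt j (j' x) x) (hc : Continuous j') (hs : HasCompactSupport j) :
    ∫ x, (j' x - deriv U x * j x) ∂(positionMeasure U) = 0 := by
  have hjc : Continuous j := continuous_iff_continuousAt.2 fun x => (hj x).continuousAt
  have hU' : Continuous (deriv U) := hU.continuous_deriv (by norm_cast)
  have hUc := hU.continuous
  have hs' : HasCompactSupport j' := by
    have : j' = deriv j := funext fun y => (hj y).deriv.symm
    rw [this]; exact hs.deriv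
  rw [integral_position]
  refine integral_eq_zero_of_hasDerivAt_of_integrable
    (f := fun x => Real.exp (-U x) / partition U * j x) (fun x => ?_) ?_ ?_
  · refine ((hasDerivAt_density hU x).fun_mul (hj x)).congr_deriv ?_
    ring
  · exact (by fun_prop : Continuous fun x => Real.exp (-U x) / partition U *
      (j' x - deriv U x * j x)).integrable_of_hasCompactSupport
      (HasCompactSupport.mul_left (hs'.sub hs.mul_left))
  · exact (by fun_prop : Continuous fun x => Real.exp (-U x) / partition U *
      j x).integrable_of_hasCompactSupport hs.mul_left

theorem integral_transport_eq_zero {U : ℝ → ℝ} (hU : ContDiff ℝ ∞ U)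
    [IsProbabilityMeasure (positionMeasure U)] {k : ℝ × ℝ → ℝ}
    (hk : ContDiff ℝ 1 k) (hs : HasCompactSupport k) :
    ∫ z, (z.2 * dx k z - deriv U z.1 * dy k z) ∂(gibbs U) = 0 := by
  have := integral_transport hU univ hk hs (β := fun _ => 0) fun y => by
    have hx := continuous_dx hk
    simpa using integral_position_ibp hU (fun x => hasDerivAt_dx hk x y) (by fun_prop)
      (hasCompactSupport_left hs y)
  simpa using this

/-- Transport is a divergence with respect to `μ`, so its integral over a half-plane is the flux
through the boundary line `x = a`. -/
theorem leftIntegral_transport {U : ℝ → ℝ} (hU : ContDiff ℝ ∞ U)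
    [IsProbabilityMeasure (positionMeasure U)] {k : ℝ × ℝ → ℝ}
    (hk : ContDiff ℝ 1 k) (hs : HasCompactSupport k) (a : ℝ) :
    leftIntegral U (fun z => z.2 * dx k z - deriv U z.1 * dy k z) a =
      Real.exp (-U a) / partition U * ∫ y, y * k (a, y) ∂(gaussianReal 0 1) := by
  have := integral_transport hU (Iic a) hk hs
    (β := fun y => Real.exp (-U a) / partition U * k (a, y)) fun y => by
      have hx := continuous_dx hk
      exact integral_Iic_position hU (fun x => hasDerivAt_dx hk x y) (by fun_prop)
        (hasCompactSupport_left hs y) a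
  rw [← integral_const_mul]
  refine this.trans (integral_congr_ae (ae_of_all _ fun y => by ring))

/-! ### The Ornstein–Uhlenbeck part on velocity fibres. -/

section TestFunction

variable {h : ℝ × ℝ → ℝ}

theorem integral_ornstein (hk : ContDiff ℝ ∞ h) (hs : HasCompactSupport h) (x : ℝ) :
    ∫ y, (dy (dy h) (x, y) - y * dy h (x, y)) ∂(gaussianReal 0 1) = 0 := by
  have h2 : ContDiff ℝ 1 (dy h) := (contDiff_dy hk).of_le (by norm_cast)
  have c1 := continuous_dy h2
  have c0 := h2.continuous
  have s0 := hasCompactSupport_dy hs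
  have s1 := hasCompactSupport_dy s0
  have ibp := integral_deriv_gaussian (fun y => hasDerivAt_dy h2 x y) (by fun_prop)
    (hasCompactSupport_right s0 x)
  rw [integral_sub (integrable_right c1 s1 x)
    (integrable_right (k := fun z => z.2 * dy h z) (by fun_prop) s0.mul_left x), ibp, sub_self]

theorem integral_mul_ornstein (hk : ContDiff ℝ ∞ h) (hs : HasCompactSupport h) (x : ℝ) :
    ∫ y, h (x, y) * (dy (dy h) (x, y) - y * dy h (x, y)) ∂(gaussianReal 0 1) =
      -∫ y, dy h (x, y) ^ 2 ∂(gaussianReal 0 1) := by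
  have h1 : ContDiff ℝ 1 h := hk.of_le (by norm_cast)
  have h2 : ContDiff ℝ 1 (dy h) := (contDiff_dy hk).of_le (by norm_cast)
  have c1 := continuous_dy h2
  have c0 := h2.continuous
  have cc := h1.continuous
  have s0 := hasCompactSupport_dy hs
  have s1 := hasCompactSupport_dy s0
  have i1 : Integrable (fun y => dy h (x, y) ^ 2) (gaussianReal 0 1) :=
    integrable_right (k := fun z => dy h z ^ 2) (by fun_prop)
      (by simp_rw [pow_two]; exact s0.mul_left) x
  have i2 : Integrable (fun y => h (x, y) * dy (dy h) (x, y)) (gaussianReal 0 1) :=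
    integrable_right (k := fun z => h z * dy (dy h) z) (by fun_prop) hs.mul_right x
  have i3 : Integrable (fun y => y * (h (x, y) * dy h (x, y))) (gaussianReal 0 1) :=
    integrable_right (k := fun z => z.2 * (h z * dy h z)) (by fun_prop)
      (HasCompactSupport.mul_left hs.mul_right) x
  have ibp := integral_deriv_gaussian (k := fun y => h (x, y) * dy h (x, y))
    (fun y => (hasDerivAt_dy h1 x y).fun_mul (hasDerivAt_dy h2 x y)) (by fun_prop)
    (hasCompactSupport_right hs x).mul_right
  have e1 : ∀ y, h (x, y) * (dy (dy h) (x, y) - y * dy h (x, y)) =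
      h (x, y) * dy (dy h) (x, y) - y * (h (x, y) * dy h (x, y)) := fun y => by ring
  have e2 : ∀ y, dy h (x, y) * dy h (x, y) + h (x, y) * dy (dy h) (x, y) =
      dy h (x, y) ^ 2 + h (x, y) * dy (dy h) (x, y) := fun y => by ring
  simp_rw [e2] at ibp
  rw [integral_add i1 i2] at ibp
  simp_rw [e1]
  rw [integral_sub i2 i3]
  linarith

theorem integral_id_mul_ornstein (hk : ContDiff ℝ ∞ h) (hs : HasCompactSupport h) (x : ℝ) :
    ∫ y, y * (dy (dy h) (x, y) - y * dy h (x, y)) ∂(gaussianReal 0 1) =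
      -∫ y, y * h (x, y) ∂(gaussianReal 0 1) := by
  have h1 : ContDiff ℝ 1 h := hk.of_le (by norm_cast)
  have h2 : ContDiff ℝ 1 (dy h) := (contDiff_dy hk).of_le (by norm_cast)
  have c1 := continuous_dy h2
  have c0 := h2.continuous
  have s0 := hasCompactSupport_dy hs
  have s1 := hasCompactSupport_dy s0
  have i2 : Integrable (fun y => y * dy (dy h) (x, y)) (gaussianReal 0 1) :=
    integrable_right (k := fun z => z.2 * dy (dy h) z) (by fun_prop) s1.mul_left x
  have i3 : Integrable (fun y => y * (y * dy h (x, y))) (gaussianReal 0 1) :=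
    integrable_right (k := fun z => z.2 * (z.2 * dy h z)) (by fun_prop)
      (HasCompactSupport.mul_left s0.mul_left) x
  have ibp1 := integral_deriv_gaussian (fun y => hasDerivAt_dy h1 x y) (by fun_prop)
    (hasCompactSupport_right hs x)
  have ibp := integral_deriv_gaussian (k := fun y => y * dy h (x, y))
    (fun y => (hasDerivAt_id y).fun_mul (hasDerivAt_dy h2 x y)) (by fun_prop)
    (hasCompactSupport_right s0 x).mul_left
  simp only [one_mul, id] at ibp
  rw [integral_add (integrable_right c0 s0 x) i2, ibp1] at ibp
  simp_rw [mul_sub]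
  rw [integral_sub i2 i3]
  linarith

end TestFunction

/-! ### Regularity of the corrector. -/

/-- Write `q = p' = U'p - r`. Since `U'p = q + r`, differentiating `p² U' ρ` gives `ρ (q² - r² + U''
p²)`, so formally `∫ q² = ∫ r² - ∫ U'' p²`. A cutoff replaces the unknown decay at infinity. The
bound does not depend on `R₀`, and of the bound on `U''` only the lower half enters. -/
theorem integral_sq_phi_deriv_le {U : ℝ → ℝ} (hU : ContDiff ℝ ∞ U)
    (hI : Integrable fun x => Real.exp (-U x)) {M : ℝ} (hM : ∀ x, |iteratedDeriv 2 U x| ≤ M)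
    {p r : ℝ → ℝ} (hr : Continuous r) (hp : ∀ x, HasDerivAt p (deriv U x * p x - r x) x)
    (hp2 : Integrable (fun x => p x ^ 2) (positionMeasure U))
    (hr2 : Integrable (fun x => r x ^ 2) (positionMeasure U)) {R₀ : ℝ} (hR : 0 ≤ R₀) :
    ∫ x in Icc (-R₀) R₀, (deriv U x * p x - r x) ^ 2 ∂(positionMeasure U) ≤
      4 * (2 * ∫ x, r x ^ 2 ∂(positionMeasure U) +
        (M + 3) * ∫ x, p x ^ 2 ∂(positionMeasure U)) := by
  have hUc := hU.continuous
  have hU' : Continuous (deriv U) := hU.continuous_deriv (by norm_cast)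
  have hU'' : ∀ x, HasDerivAt (deriv U) (iteratedDeriv 2 U x) x := fun x => by
    have : ContDiff ℝ 1 (deriv U) := ((contDiff_infty_iff_deriv.1 hU).2).of_le (by norm_cast)
    rw [iteratedDeriv_succ, iteratedDeriv_one]
    exact (this.differentiable (by norm_num) x).hasDerivAt
  have hU2c : Continuous (iteratedDeriv 2 U) := hU.continuous_iteratedDeriv 2 (by norm_cast)
  have hpc : Continuous p := continuous_iff_continuousAt.2 fun x => (hp x).continuousAt
  have hM0 : 0 ≤ M := (abs_nonneg _).trans (hM 0)
  have hZ := partition_pos hI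
  set ρ : ℝ → ℝ := fun x => Real.exp (-U x) / partition U with hρ
  have hρ0 : ∀ x, 0 < ρ x := fun x => div_pos (Real.exp_pos _) hZ
  have hρc : Continuous ρ := by fun_prop
  set q : ℝ → ℝ := fun x => deriv U x * p x - r x with hq
  have hqc : Continuous q := by fun_prop
  -- `R ≥ 2` gives `|χ'| ≤ 1` on `[-R, R]`, and `R ≥ 2 R₀` gives `χ ≥ 3/4` on `[-R₀, R₀]`. As `χ`
  -- vanishes at `±R`, so does `T`.
  set R := 2 * (R₀ + 1) with hRdef
  have hR2 : 2 ≤ R := by linarith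
  set χ : ℝ → ℝ := fun x => 1 - x ^ 2 / R ^ 2 with hχ
  set χ' : ℝ → ℝ := fun x => -(2 * x / R ^ 2) with hχ'
  have hχd : ∀ x, HasDerivAt χ (χ' x) x := fun x => by
    refine (((hasDerivAt_pow 2 x).div_const (R ^ 2)).const_sub 1).congr_deriv ?_
    simp [hχ']
  have hχc : Continuous χ := by fun_prop
  have hχ'c : Continuous χ' := by fun_prop
  set T : ℝ → ℝ := fun x => χ x ^ 2 * p x ^ 2 * deriv U x * ρ x with hT
  set T' : ℝ → ℝ := fun x => ρ x * (2 * χ x * χ' x * p x * (q x + r x) +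
    χ x ^ 2 * (q x ^ 2 - r x ^ 2 + iteratedDeriv 2 U x * p x ^ 2)) with hT'
  have hTd : ∀ x, HasDerivAt T (T' x) x := fun x => by
    refine (((((hχd x).fun_pow 2).fun_mul ((hp x).fun_pow 2)).fun_mul (hU'' x)).fun_mul
      (hasDerivAt_density hU x)).congr_deriv ?_
    simp only [hT', hq, hρ]
    push_cast
    ring
  have hT'c : Continuous T' := by fun_prop
  have h0 : ∫ x in (-R)..R, T' x = 0 := by
    rw [intervalIntegral.integral_eq_sub_of_hasDerivAt (fun x _ => hTd x)
      (hT'c.intervalIntegrable _ _)]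
    have : R ≠ 0 := by linarith
    simp [hT, hχ, this]
  set e : ℝ → ℝ := fun x => ρ x * (2 * r x ^ 2 + (M + 3) * p x ^ 2) with he
  have hec : Continuous e := by fun_prop
  have hpt : ∀ x ∈ Icc (-R) R, ρ x * (1 / 2 * χ x ^ 2 * q x ^ 2) ≤ T' x + e x := by
    intro x hx
    have hx2 : x ^ 2 ≤ R ^ 2 := sq_le_sq' hx.1 hx.2
    have a1 : 0 ≤ χ x := by
      simp only [hχ, sub_nonneg]; exact div_le_one_of_le₀ hx2 (by positivity)
    have a2 : χ x ≤ 1 := by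
      have : 0 ≤ x ^ 2 / R ^ 2 := by positivity
      simp only [hχ]; linarith
    have a3 : χ' x ^ 2 ≤ 1 := by
      have : χ' x ^ 2 = 4 * x ^ 2 / (R ^ 2 * R ^ 2) := by
        simp only [hχ']; field_simp; ring
      rw [this]
      refine div_le_one_of_le₀ ?_ (by positivity)
      have h4 : 4 ≤ R ^ 2 := by nlinarith
      nlinarith [mul_le_mul_of_nonneg_right h4 (sq_nonneg R)]
    have a4 : χ x ^ 2 ≤ 1 := by nlinarith
    have a5 := (abs_le.1 (hM x)).1
    simp only [hT', he, ← mul_add]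
    refine mul_le_mul_of_nonneg_left ?_ (hρ0 x).le
    have b1 : χ x ^ 2 * (-M) * p x ^ 2 ≤ χ x ^ 2 * iteratedDeriv 2 U x * p x ^ 2 := by gcongr
    have b2 : χ x ^ 2 * M * p x ^ 2 ≤ 1 * M * p x ^ 2 := by gcongr
    have b3 : χ x ^ 2 * r x ^ 2 ≤ 1 * r x ^ 2 := by gcongr
    have b4 : χ' x ^ 2 * p x ^ 2 ≤ 1 * p x ^ 2 := by gcongr
    -- The two squares absorb the cutoff cross term `2 χ χ' p (q + r)`, at the cost of half of `χ²
    -- q²`, one more `r²` and `3 p²`.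
    nlinarith [sq_nonneg (χ x * q x + 2 * (χ' x * p x)), sq_nonneg (χ x * r x + χ' x * p x)]
  have hRR : -R ≤ R := by linarith
  have h1 : ∫ x in (-R)..R, ρ x * (1 / 2 * χ x ^ 2 * q x ^ 2) ≤ ∫ x in (-R)..R, e x := by
    have := intervalIntegral.integral_mono_on (μ := volume) hRR
      ((by fun_prop : Continuous fun x => ρ x * (1 / 2 * χ x ^ 2 * q x ^ 2)).intervalIntegrable
        _ _) ((hT'c.add hec).intervalIntegrable _ _) hpt
    refine this.trans_eq ?_
    simp only [Pi.add_apply]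
    rw [intervalIntegral.integral_add (hT'c.intervalIntegrable _ _)
      (hec.intervalIntegrable _ _), h0, zero_add]
  have hint : ∀ f : ℝ → ℝ, Integrable f (positionMeasure U) → Integrable fun x => ρ x * f x := by
    intro f hf
    rw [positionMeasure, integrable_tilted_iff hI] at hf
    refine (hf.div_const (partition U)).congr (ae_of_all _ fun x => ?_)
    simp only [hρ, smul_eq_mul]; ring
  have h2 : ∫ x in (-R)..R, e x ≤ 2 * ∫ x, r x ^ 2 ∂(positionMeasure U) +
        (M + 3) * ∫ x, p x ^ 2 ∂(positionMeasure U) := by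
    have i1 := (hr2.const_mul 2).add (hp2.const_mul (M + 3))
    rw [← integral_const_mul, ← integral_const_mul, ← integral_add (hr2.const_mul 2)
      (hp2.const_mul (M + 3)), integral_position, intervalIntegral.integral_of_le hRR]
    refine setIntegral_le_integral (hint _ i1) (ae_of_all _ fun x => ?_)
    have := (hρ0 x).le
    simp only [Pi.zero_apply, he]; positivity
  have h3 : ∫ x in Icc (-R₀) R₀, q x ^ 2 ∂(positionMeasure U) ≤
      4 * ∫ x in (-R)..R, ρ x * (1 / 2 * χ x ^ 2 * q x ^ 2) := by
    rw [setIntegral_position, intervalIntegral.integral_of_le hRR,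
      ← integral_Icc_eq_integral_Ioc, ← integral_const_mul]
    have hc1 : Continuous fun x => 4 * (ρ x * (1 / 2 * χ x ^ 2 * q x ^ 2)) := by fun_prop
    refine (setIntegral_mono_on
      ((by fun_prop : Continuous fun x => ρ x * q x ^ 2).integrableOn_Icc)
      hc1.integrableOn_Icc measurableSet_Icc fun x hx => ?_).trans
      (setIntegral_mono_set hc1.integrableOn_Icc (ae_of_all _ fun x => ?_)
        (Icc_subset_Icc (by linarith) (by linarith)).eventuallyLE)
    · have hx2 : x ^ 2 ≤ R₀ ^ 2 := sq_le_sq' hx.1 hx.2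
      have : 3 / 4 ≤ χ x := by
        have : x ^ 2 / R ^ 2 ≤ 1 / 4 := by
          rw [div_le_iff₀ (by positivity)]; nlinarith
        simp only [hχ]; linarith
      have : 1 / 2 ≤ χ x ^ 2 := by nlinarith
      have a := hρ0 x
      have : 0 ≤ ρ x * q x ^ 2 := by positivity
      change ρ x * q x ^ 2 ≤ _
      nlinarith
    · have := (hρ0 x).le
      simp only [Pi.zero_apply]; positivity
  linarith

theorem hasDerivAt_primitive_Iic {f : ℝ → ℝ} (hf : Integrable f) (hc : Continuous f) (x : ℝ) :
    HasDerivAt (fun x => ∫ t in Iic x, f t) (f x) x := by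
  have e : (fun x => ∫ t in Iic x, f t) = fun x => (∫ t in Iic (0 : ℝ), f t) +
      ∫ t in (0 : ℝ)..x, f t := by
    funext x
    rw [← intervalIntegral.integral_Iic_sub_Iic hf.integrableOn hf.integrableOn]; ring
  rw [e]
  exact (intervalIntegral.integral_hasDerivAt_right (hc.intervalIntegrable _ _)
    (hc.stronglyMeasurableAtFilter _ _) hc.continuousAt).const_add _

section

variable {U : ℝ → ℝ} [IsProbabilityMeasure (positionMeasure U)] {h : ℝ × ℝ → ℝ}

theorem integrable_gibbs {k : ℝ × ℝ → ℝ} (hk : Continuous k) (hs : HasCompactSupport k) :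
    Integrable k (gibbs U) := by
  unfold gibbs; exact hk.integrable_of_hasCompactSupport hs

theorem leftIntegral_sub_mean (hc : Continuous h) (hs : HasCompactSupport h) (x : ℝ) :
    leftIntegral U (fun z => h z - ∫ w, h w ∂(gibbs U)) x =
      ∫ t in Iic x, (∫ y, h (t, y) ∂(gaussianReal 0 1) - ∫ w, h w ∂(gibbs U))
        ∂(positionMeasure U) := by
  have i := integrable_sub (integrable_gibbs (U := U) hc hs)
    (integrable_const (∫ w, h w ∂(gibbs U)))
  have i' := i.integrableOn (s := {z | z.1 ∈ Iic x})
  rw [IntegrableOn, gibbs_restrict] at i'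
  have e : leftIntegral U (fun z => h z - ∫ w, h w ∂(gibbs U)) x =
    ∫ z in {z | z.1 ∈ Iic x}, (h z - ∫ w, h w ∂(gibbs U)) ∂(gibbs U) := rfl
  rw [e]
  conv_lhs => rw [gibbs_restrict]
  rw [integral_prod _ i']
  refine integral_congr_ae (ae_of_all _ fun t => ?_)
  simp only
  rw [integral_sub (integrable_right hc hs t) (integrable_const _)]
  simp

theorem hasDerivAt_phi (hU : ContDiff ℝ ∞ U) (hI : Integrable fun x => Real.exp (-U x))
    (hc : Continuous h) (hs : HasCompactSupport h) (x : ℝ) :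
    HasDerivAt (phi U h) (deriv U x * phi U h x -
      (∫ y, h (x, y) ∂(gaussianReal 0 1) - ∫ w, h w ∂(gibbs U))) x := by
  have hUc := hU.continuous
  have hZ := (partition_pos hI).ne'
  set m := ∫ w, h w ∂(gibbs U) with hm
  have uc := continuous_integral hc hs
  set u : ℝ → ℝ := fun x => ∫ y, h (x, y) ∂(gaussianReal 0 1) with hu
  have us : HasCompactSupport u := hasCompactSupport_integral hs
  have hρ : Integrable fun x => Real.exp (-U x) / partition U * (u x - m) := by
    have i1 : Integrable fun x => Real.exp (-U x) / partition U * u x :=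
      (by fun_prop : Continuous fun x => Real.exp (-U x) / partition U * u x
        ).integrable_of_hasCompactSupport us.mul_left
    have i2 := (hI.div_const (partition U)).mul_const m
    refine (i1.sub i2).congr (ae_of_all _ fun x => ?_)
    simp only [Pi.sub_apply]; ring
  have hL : ∀ x, HasDerivAt (leftIntegral U fun z => h z - m)
      (Real.exp (-U x) / partition U * (u x - m)) x := by
    intro x
    have : (leftIntegral U fun z => h z - m) = fun x =>
        ∫ t in Iic x, Real.exp (-U t) / partition U * (u t - m) := by
      funext x
      rw [leftIntegral_sub_mean hc hs, setIntegral_position]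
    rw [this]
    exact hasDerivAt_primitive_Iic hρ (by fun_prop) x
  have hE : HasDerivAt (fun x => Real.exp (U x)) (Real.exp (U x) * deriv U x) x :=
    ((hU.differentiable (by simp) x).hasDerivAt).exp
  refine (((hE.const_mul (partition U)).fun_mul (hL x)).fun_neg).congr_deriv ?_
  simp only [phi, ← hm]
  rw [Real.exp_neg]
  field_simp
  ring

/-- `φ` depends on `h` only through its velocity average, so `phi_bound` may be applied to that
average. This sharpens the right-hand side to the macroscopic variance, as the absorption in
`dissipation` requires. -/
theorem phi_bound_marginal (hU : ContDiff ℝ ∞ U) (hI : Integrable fun x => Real.exp (-U x))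
    {c : ℝ} (hc0 : 0 < c) (hP : Poincare (positionMeasure U) c)
    (hc : Continuous h) (hs : HasCompactSupport h) :
    Integrable (fun x => phi U h x ^ 2) (positionMeasure U) ∧
    c * ∫ x, phi U h x ^ 2 ∂(positionMeasure U) ≤
      ∫ x, (∫ y, h (x, y) ∂(gaussianReal 0 1) - ∫ w, h w ∂(gibbs U)) ^ 2 ∂(positionMeasure U) := by
  have uc := continuous_integral hc hs
  have us := hasCompactSupport_integral hs
  have hm := integral_gibbs U hc hs
  set u : ℝ → ℝ := fun x => ∫ y, h (x, y) ∂(gaussianReal 0 1) with hu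
  obtain ⟨C, hC⟩ := us.exists_bound_of_continuous uc
  have hL : MemLp (fun z : ℝ × ℝ => u z.1) 2 (gibbs U) :=
    MemLp.of_bound (uc.comp continuous_fst).aestronglyMeasurable C (ae_of_all _ fun z => hC z.1)
  have key := phi_bound hU.continuous hI hc0 hP hL
  have hmu : ∫ w, u w.1 ∂(gibbs U) = ∫ w, h w ∂(gibbs U) := by
    rw [map_fst_gibbs U u, hm]
  have hphi : phi U (fun z : ℝ × ℝ => u z.1) = phi U h := by
    funext x
    unfold phi
    rw [leftIntegral_sub_mean hc hs, hmu]
    congr 2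
    have e : leftIntegral U (fun z => u z.1 - ∫ w, h w ∂(gibbs U)) x =
      ∫ z in {z | z.1 ∈ Iic x}, (u z.1 - ∫ w, h w ∂(gibbs U)) ∂(gibbs U) := rfl
    rw [e]
    conv_lhs => rw [gibbs_restrict]
    rw [integral_fun_fst (fun t => u t - ∫ w, h w ∂(gibbs U))]
    simp [hu]
  rw [hphi, hmu, map_fst_gibbs U (fun x => (u x - ∫ w, h w ∂(gibbs U)) ^ 2)] at key
  exact key

end

/-! ### The generator on test functions and the dissipation of the modified energy. -/

theorem integrable_sq_of_hasCompactSupport {f : ℝ → ℝ} {μ : Measure ℝ}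
    [IsFiniteMeasureOnCompacts μ] (hc : Continuous f) (hs : HasCompactSupport f) :
    Integrable (fun x => f x ^ 2) μ := by
  simp_rw [pow_two]
  exact (hc.mul hc).integrable_of_hasCompactSupport hs.mul_left

section

variable {U : ℝ → ℝ} [IsProbabilityMeasure (positionMeasure U)] {h : ℝ × ℝ → ℝ}

/-- Transport of `h²` integrates to zero, so the Hamiltonian part is antisymmetric and only the
velocity diffusion dissipates. -/
theorem integral_mul_diffOp (hU : ContDiff ℝ ∞ U) (hk : ContDiff ℝ ∞ h)
    (hs : HasCompactSupport h) :
    ∫ z, h z * diffOp U h z ∂(gibbs U) =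
      -∫ x, ∫ y, dy h (x, y) ^ 2 ∂(gaussianReal 0 1) ∂(positionMeasure U) := by
  have h1 : ContDiff ℝ 1 h := hk.of_le (by norm_cast)
  have h2 : ContDiff ℝ 1 (dy h) := (contDiff_dy hk).of_le (by norm_cast)
  have hU' : Continuous (deriv U) := hU.continuous_deriv (by norm_cast)
  have cc := h1.continuous
  have c0 := continuous_dx h1
  have c1 := continuous_dy h1
  have c2 := continuous_dy h2
  have sq : ContDiff ℝ 1 (fun z => h z * h z) := h1.mul h1
  have ssq : HasCompactSupport (fun z => h z * h z) := hs.mul_left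
  have ex : ∀ z, dx (fun z => h z * h z) z = 2 * h z * dx h z := fun z =>
    (hasDerivAt_dx sq z.1 z.2).unique (((hasDerivAt_dx h1 z.1 z.2).fun_mul
      (hasDerivAt_dx h1 z.1 z.2)).congr_deriv (by simp only [Prod.mk.eta]; ring))
  have ey : ∀ z, dy (fun z => h z * h z) z = 2 * h z * dy h z := fun z =>
    (hasDerivAt_dy sq z.1 z.2).unique (((hasDerivAt_dy h1 z.1 z.2).fun_mul
      (hasDerivAt_dy h1 z.1 z.2)).congr_deriv (by simp only [Prod.mk.eta]; ring))
  have ht := integral_transport_eq_zero hU sq ssq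
  simp_rw [ex, ey] at ht
  have i1 : Integrable (fun z : ℝ × ℝ => z.2 * (2 * h z * dx h z) -
      deriv U z.1 * (2 * h z * dy h z)) (gibbs U) :=
    integrable_gibbs (by fun_prop)
      ((HasCompactSupport.mul_left (HasCompactSupport.mul_right hs.mul_left)).sub
        (HasCompactSupport.mul_left (HasCompactSupport.mul_right hs.mul_left)))
  have cO : Continuous fun z : ℝ × ℝ => h z * (dy (dy h) z - z.2 * dy h z) := by fun_prop
  have sO : HasCompactSupport fun z : ℝ × ℝ => h z * (dy (dy h) z - z.2 * dy h z) := hs.mul_right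
  have e : ∀ z, h z * diffOp U h z = 1 / 2 * (z.2 * (2 * h z * dx h z) -
      deriv U z.1 * (2 * h z * dy h z)) + h z * (dy (dy h) z - z.2 * dy h z) := fun z => by
    rw [diffOp_eq U hk]; ring
  simp_rw [e]
  rw [integral_add (i1.const_mul _) (integrable_gibbs cO sO), integral_const_mul, ht, mul_zero,
    zero_add, integral_gibbs U cO sO, ← integral_neg]
  exact integral_congr_ae (ae_of_all _ fun x => integral_mul_ornstein hk hs x)

theorem setIntegral_diffOp (hU : ContDiff ℝ ∞ U) (hk : ContDiff ℝ ∞ h)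
    (hs : HasCompactSupport h) (S : Set ℝ) :
    ∫ z in {z | z.1 ∈ S}, diffOp U h z ∂(gibbs U) =
      ∫ z in {z | z.1 ∈ S}, (z.2 * dx h z - deriv U z.1 * dy h z) ∂(gibbs U) := by
  have h1 : ContDiff ℝ 1 h := hk.of_le (by norm_cast)
  have h2 : ContDiff ℝ 1 (dy h) := (contDiff_dy hk).of_le (by norm_cast)
  have hU' : Continuous (deriv U) := hU.continuous_deriv (by norm_cast)
  have c0 := continuous_dx h1
  have c1 := continuous_dy h1
  have c2 := continuous_dy h2
  have s0 := hasCompactSupport_dx hs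
  have s1 := hasCompactSupport_dy hs
  have s2 := hasCompactSupport_dy s1
  have i1 : Integrable (fun z : ℝ × ℝ => z.2 * dx h z - deriv U z.1 * dy h z) (gibbs U) :=
    integrable_gibbs (by fun_prop) (s0.mul_left.sub s1.mul_left)
  have cO : Continuous fun z : ℝ × ℝ => dy (dy h) z - z.2 * dy h z := by fun_prop
  have sO : HasCompactSupport fun z : ℝ × ℝ => dy (dy h) z - z.2 * dy h z := s2.sub s1.mul_left
  have e : ∀ z, diffOp U h z = (z.2 * dx h z - deriv U z.1 * dy h z) +
      (dy (dy h) z - z.2 * dy h z) := fun z => by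
    rw [diffOp_eq U hk]; ring
  simp_rw [e]
  rw [integral_add i1.integrableOn (integrable_gibbs cO sO).integrableOn,
    integral_gibbs_restrict U S cO sO]
  simp_rw [integral_ornstein hk hs]
  simp

theorem integral_diffOp (hU : ContDiff ℝ ∞ U) (hk : ContDiff ℝ ∞ h)
    (hs : HasCompactSupport h) : ∫ z, diffOp U h z ∂(gibbs U) = 0 := by
  have := setIntegral_diffOp (U := U) hU hk hs univ
  simp only [mem_univ, ofPred_true, Measure.restrict_univ] at this
  rw [this, integral_transport_eq_zero hU (hk.of_le (by norm_cast)) hs]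

/-- The Ornstein–Uhlenbeck part averages to zero on each fibre, and the transport part integrates to
a flux whose density factor cancels the weight in `phi`. No derivative of `h` survives. -/
theorem phi_diffOp (hU : ContDiff ℝ ∞ U) (hI : Integrable fun x => Real.exp (-U x))
    (hk : ContDiff ℝ ∞ h) (hs : HasCompactSupport h) (x : ℝ) :
    phi U (diffOp U h) x = -∫ y, y * h (x, y) ∂(gaussianReal 0 1) := by
  have e : leftIntegral U (diffOp U h) x =
      leftIntegral U (fun z => z.2 * dx h z - deriv U z.1 * dy h z) x :=
    setIntegral_diffOp hU hk hs (Iic x)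
  have hZ := (partition_pos hI).ne'
  unfold phi
  rw [integral_diffOp hU hk hs]
  simp only [sub_zero]
  rw [e, leftIntegral_transport hU (hk.of_le (by norm_cast)) hs, Real.exp_neg]
  field_simp

/-- The total transport of `φ(x) y h` is zero, which moves the derivatives from `h` onto `y φ`. The
equation for `φ` produces `r`, and `q = φ'` is left against the second Hermite moment. Since `y` is
an eigenfunction of the Ornstein–Uhlenbeck operator, the remaining term is `-φ` times the first
moment. -/
theorem integral_phi_mul_diffOp (hU : ContDiff ℝ ∞ U) (hI : Integrable fun x => Real.exp (-U x))
    (hk : ContDiff ℝ ∞ h) (hs : HasCompactSupport h) {r q : ℝ → ℝ}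
    (hr : r = fun x => ∫ y, h (x, y) ∂(gaussianReal 0 1) - ∫ w, h w ∂(gibbs U))
    (hq : q = fun x => deriv U x * phi U h x - r x) :
    ∫ z, phi U h z.1 * z.2 * diffOp U h z ∂(gibbs U) =
      ∫ x, r x * (∫ y, h (x, y) ∂(gaussianReal 0 1)) ∂(positionMeasure U) -
      ∫ x, q x * (∫ y, (y ^ 2 - 1) * h (x, y) ∂(gaussianReal 0 1)) ∂(positionMeasure U) -
      ∫ x, phi U h x * (∫ y, y * h (x, y) ∂(gaussianReal 0 1)) ∂(positionMeasure U) := by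
  have h1 : ContDiff ℝ 1 h := hk.of_le (by norm_cast)
  have h2 : ContDiff ℝ 1 (dy h) := (contDiff_dy hk).of_le (by norm_cast)
  have hU' : Continuous (deriv U) := hU.continuous_deriv (by norm_cast)
  have cc := h1.continuous
  have c0 := continuous_dx h1
  have c1 := continuous_dy h1
  have c2 := continuous_dy h2
  have s0 := hasCompactSupport_dx hs
  have s1 := hasCompactSupport_dy hs
  have s2 := hasCompactSupport_dy s1
  have rc : Continuous r := by
    rw [hr]; exact (continuous_integral cc hs).sub continuous_const
  have pd : ∀ x, HasDerivAt (phi U h) (q x) x := fun x => by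
    rw [hq, hr]; exact hasDerivAt_phi hU hI cc hs x
  have pc : Continuous (phi U h) := continuous_iff_continuousAt.2 fun x => (pd x).continuousAt
  have qc : Continuous q := by rw [hq]; fun_prop
  have p1 : ContDiff ℝ 1 (phi U h) := contDiff_one_iff_deriv.2
    ⟨fun x => (pd x).differentiableAt, by rw [funext fun x => (pd x).deriv]; exact qc⟩
  set k : ℝ × ℝ → ℝ := fun z => phi U h z.1 * (z.2 * h z) with hkdef
  have k1 : ContDiff ℝ 1 k := (p1.comp contDiff_fst).mul (contDiff_snd.mul h1)
  have ks : HasCompactSupport k := HasCompactSupport.mul_left hs.mul_left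
  have ex : ∀ z, dx k z = q z.1 * (z.2 * h z) + phi U h z.1 * (z.2 * dx h z) := fun z =>
    (hasDerivAt_dx k1 z.1 z.2).unique ((pd z.1).fun_mul ((hasDerivAt_dx h1 z.1 z.2).const_mul z.2))
  have ey : ∀ z, dy k z = phi U h z.1 * (1 * h z + z.2 * dy h z) := fun z =>
    (hasDerivAt_dy k1 z.1 z.2).unique
      (((hasDerivAt_id z.2).fun_mul (hasDerivAt_dy h1 z.1 z.2)).const_mul (phi U h z.1))
  have ht := integral_transport_eq_zero hU k1 ks
  have e1 : ∀ z : ℝ × ℝ, z.2 * dx k z - deriv U z.1 * dy k z =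
      phi U h z.1 * (z.2 * (z.2 * dx h z - deriv U z.1 * dy h z)) +
        q z.1 * ((z.2 ^ 2 - 1) * h z) - r z.1 * h z := fun z => by
    rw [ex, ey, hq]; ring
  have i1 : Integrable (fun z : ℝ × ℝ =>
      phi U h z.1 * (z.2 * (z.2 * dx h z - deriv U z.1 * dy h z))) (gibbs U) :=
    integrable_gibbs (by fun_prop) (HasCompactSupport.mul_left (HasCompactSupport.mul_left
      (s0.mul_left.sub s1.mul_left)))
  have cw : Continuous (fun z : ℝ × ℝ => q z.1 * ((z.2 ^ 2 - 1) * h z)) := by fun_prop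
  have sw : HasCompactSupport (fun z : ℝ × ℝ => q z.1 * ((z.2 ^ 2 - 1) * h z)) :=
    HasCompactSupport.mul_left hs.mul_left
  have cu : Continuous (fun z : ℝ × ℝ => r z.1 * h z) := by fun_prop
  have su : HasCompactSupport (fun z : ℝ × ℝ => r z.1 * h z) := hs.mul_left
  have cv : Continuous (fun z : ℝ × ℝ => phi U h z.1 * (z.2 * (dy (dy h) z - z.2 * dy h z))) := by
    fun_prop
  have sv : HasCompactSupport
      (fun z : ℝ × ℝ => phi U h z.1 * (z.2 * (dy (dy h) z - z.2 * dy h z))) :=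
    HasCompactSupport.mul_left (HasCompactSupport.mul_left (s2.sub s1.mul_left))
  simp_rw [e1] at ht
  rw [integral_sub (i1.fun_add (integrable_gibbs cw sw)) (integrable_gibbs cu su),
    integral_add i1 (integrable_gibbs cw sw), integral_gibbs U cw sw, integral_gibbs U cu su] at ht
  have e2 : ∀ z : ℝ × ℝ, phi U h z.1 * z.2 * diffOp U h z =
      phi U h z.1 * (z.2 * (z.2 * dx h z - deriv U z.1 * dy h z)) +
        phi U h z.1 * (z.2 * (dy (dy h) z - z.2 * dy h z)) := fun z => by
    rw [diffOp_eq U hk]; ring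
  simp_rw [e2]
  rw [integral_add i1 (integrable_gibbs cv sv), integral_gibbs U cv sv]
  simp_rw [integral_const_mul] at ht ⊢
  simp_rw [integral_id_mul_ornstein hk hs, mul_neg]
  rw [integral_neg]
  linarith

set_option maxHeartbeats 400000 in
/-- The dissipation inequality of the modified energy on test functions. -/
theorem dissipation (hU : ContDiff ℝ ∞ U) (hI : Integrable fun x => Real.exp (-U x))
    {c M : ℝ} (hc : 0 < c) (hP : Poincare (positionMeasure U) c)
    (hM : ∀ x, |iteratedDeriv 2 U x| ≤ M) (hk : ContDiff ℝ ∞ h) (hs : HasCompactSupport h)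
    {B ε : ℝ} (hB : B = 8 * (2 + (M + 3) / c) + 1 / c) (hε : 0 < ε) (hεB : ε * (3 + B) ≤ 2) :
    2 * ∫ z, h z * diffOp U h z ∂(gibbs U) -
      2 * ε * (∫ z, phi U (diffOp U h) z.1 * z.2 * h z ∂(gibbs U) +
        ∫ z, phi U h z.1 * z.2 * diffOp U h z ∂(gibbs U)) ≤
      -ε * (∫ z, h z ^ 2 ∂(gibbs U) - (∫ z, h z ∂(gibbs U)) ^ 2) := by
  have h1 : ContDiff ℝ 1 h := hk.of_le (by norm_cast)
  have hU' : Continuous (deriv U) := hU.continuous_deriv (by norm_cast)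
  have cc := h1.continuous
  have c1 := continuous_dy h1
  have s1 := hasCompactSupport_dy hs
  have hM0 : 0 ≤ M := (abs_nonneg _).trans (hM 0)
  have hB0 : 0 < B := by rw [hB]; positivity
  set m := ∫ z, h z ∂(gibbs U) with hm
  set u : ℝ → ℝ := fun x => ∫ y, h (x, y) ∂(gaussianReal 0 1) with hu
  set v : ℝ → ℝ := fun x => ∫ y, y * h (x, y) ∂(gaussianReal 0 1) with hv
  set w : ℝ → ℝ := fun x => ∫ y, (y ^ 2 - 1) * h (x, y) ∂(gaussianReal 0 1) with hw
  set s : ℝ → ℝ := fun x => ∫ y, h (x, y) ^ 2 ∂(gaussianReal 0 1) with hsdef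
  set d : ℝ → ℝ := fun x => ∫ y, dy h (x, y) ^ 2 ∂(gaussianReal 0 1) with hd
  set r : ℝ → ℝ := fun x => u x - m with hr
  set q : ℝ → ℝ := fun x => deriv U x * phi U h x - r x with hq
  have ss2 : HasCompactSupport fun z => h z ^ 2 := by simp_rw [pow_two]; exact hs.mul_left
  have sd2 : HasCompactSupport fun z => dy h z ^ 2 := by simp_rw [pow_two]; exact s1.mul_left
  have uc : Continuous u := continuous_integral cc hs
  have us : HasCompactSupport u := hasCompactSupport_integral hs
  have vc : Continuous v := continuous_integral (k := fun z => z.2 * h z) (by fun_prop) hs.mul_left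
  have vs : HasCompactSupport v :=
    hasCompactSupport_integral (k := fun z => z.2 * h z) hs.mul_left
  have wc : Continuous w :=
    continuous_integral (k := fun z => (z.2 ^ 2 - 1) * h z) (by fun_prop) hs.mul_left
  have ws : HasCompactSupport w :=
    hasCompactSupport_integral (k := fun z => (z.2 ^ 2 - 1) * h z) hs.mul_left
  have sc : Continuous s := continuous_integral (k := fun z => h z ^ 2) (by fun_prop) ss2
  have sss : HasCompactSupport s := hasCompactSupport_integral (k := fun z => h z ^ 2) ss2
  have dc : Continuous d := continuous_integral (k := fun z => dy h z ^ 2) (by fun_prop) sd2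
  have ds : HasCompactSupport d := hasCompactSupport_integral (k := fun z => dy h z ^ 2) sd2
  have rc : Continuous r := uc.sub continuous_const
  have pd : ∀ x, HasDerivAt (phi U h) (q x) x := fun x => hasDerivAt_phi hU hI cc hs x
  have pc : Continuous (phi U h) := continuous_iff_continuousAt.2 fun x => (pd x).continuousAt
  have qc : Continuous q := by fun_prop
  have ui : Integrable u (positionMeasure U) := uc.integrable_of_hasCompactSupport us
  have u2i : Integrable (fun x => u x ^ 2) (positionMeasure U) :=
    integrable_sq_of_hasCompactSupport uc us
  have v2i : Integrable (fun x => v x ^ 2) (positionMeasure U) :=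
    integrable_sq_of_hasCompactSupport vc vs
  have si : Integrable s (positionMeasure U) := sc.integrable_of_hasCompactSupport sss
  have di : Integrable d (positionMeasure U) := dc.integrable_of_hasCompactSupport ds
  have pvi : Integrable (fun x => phi U h x * v x) (positionMeasure U) :=
    (pc.mul vc).integrable_of_hasCompactSupport vs.mul_left
  have qwi : Integrable (fun x => q x * w x) (positionMeasure U) :=
    (qc.mul wc).integrable_of_hasCompactSupport ws.mul_left
  have um : ∫ x, u x ∂(positionMeasure U) = m := (integral_gibbs U cc hs).symm
  have r2e : ∀ x, r x ^ 2 = u x ^ 2 - (2 * m * u x - m ^ 2) := fun x => by simp only [hr]; ring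
  have i3 : Integrable (fun x => 2 * m * u x - m ^ 2) (positionMeasure U) :=
    integrable_sub (ui.const_mul _) (integrable_const _)
  have r2i : Integrable (fun x => r x ^ 2) (positionMeasure U) := by
    simp_rw [r2e]; exact integrable_sub u2i i3
  have r2 : ∫ x, r x ^ 2 ∂(positionMeasure U) = ∫ x, u x ^ 2 ∂(positionMeasure U) - m ^ 2 := by
    simp_rw [r2e]
    rw [integral_sub u2i i3, integral_sub (ui.const_mul _) (integrable_const _),
      integral_const_mul, um]
    simp; ring
  have ru : ∫ x, r x * u x ∂(positionMeasure U) = ∫ x, r x ^ 2 ∂(positionMeasure U) := by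
    have e : ∀ x, r x * u x = u x ^ 2 - m * u x := fun x => by simp only [hr]; ring
    simp_rw [e]
    rw [r2, integral_sub u2i (ui.const_mul _), integral_const_mul, um]; ring
  obtain ⟨pi, pb⟩ := phi_bound_marginal hU hI hc hP cc hs
  change c * _ ≤ ∫ x, r x ^ 2 ∂(positionMeasure U) at pb
  -- `q` is paired only with the compactly supported `w`, so the local bound on `∫ q²` suffices and
  -- its global integrability is never needed.
  obtain ⟨R₀, hR₀, hwR⟩ : ∃ R₀ : ℝ, 0 ≤ R₀ ∧ ∀ x, x ∉ Icc (-R₀) R₀ → w x = 0 := by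
    obtain ⟨R, hR⟩ := ws.isCompact.isBounded.subset_closedBall 0
    refine ⟨max R 0, le_max_right _ _, fun x hx => ?_⟩
    by_contra hne
    have := hR (subset_tsupport _ hne)
    rw [Metric.mem_closedBall, Real.dist_eq, sub_zero] at this
    exact hx (abs_le.1 (this.trans (le_max_left _ _)))
  have qb := integral_sq_phi_deriv_le hU hI hM rc pd pi r2i hR₀
  change ∫ x in Icc (-R₀) R₀, q x ^ 2 ∂(positionMeasure U) ≤ _ at qb
  have eA : ∫ z, phi U (diffOp U h) z.1 * z.2 * h z ∂(gibbs U) =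
      -∫ x, v x ^ 2 ∂(positionMeasure U) := by
    simp_rw [phi_diffOp hU hI hk hs]
    have e : ∀ z : ℝ × ℝ, (-∫ y, y * h (z.1, y) ∂(gaussianReal 0 1)) * z.2 * h z =
        -(v z.1) * (z.2 * h z) := fun z => by simp only [hv]; ring
    simp_rw [e]
    rw [integral_gibbs U (k := fun z => -(v z.1) * (z.2 * h z)) (by fun_prop)
      (HasCompactSupport.mul_left hs.mul_left), ← integral_neg]
    refine integral_congr_ae (ae_of_all _ fun x => ?_)
    simp only [integral_const_mul]
    change -(v x) * v x = _
    ring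
  have eS : ∫ z, h z ^ 2 ∂(gibbs U) = ∫ x, s x ∂(positionMeasure U) :=
    integral_gibbs U (k := fun z => h z ^ 2) (by fun_prop) ss2
  rw [eA, eS, integral_mul_diffOp hU hk hs, integral_phi_mul_diffOp hU hI hk hs rfl rfl]
  change 2 * -∫ x, d x ∂(positionMeasure U) - 2 * ε * (-∫ x, v x ^ 2 ∂(positionMeasure U) +
    (∫ x, r x * u x ∂(positionMeasure U) - ∫ x, q x * w x ∂(positionMeasure U) -
      ∫ x, phi U h x * v x ∂(positionMeasure U))) ≤ _
  have bes : ∀ x, u x ^ 2 + v x ^ 2 + w x ^ 2 / 2 ≤ s x := fun x =>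
    bessel_gaussian (g := fun y => h (x, y)) (by fun_prop) (hasCompactSupport_right hs x)
  have poi : ∀ x, s x - u x ^ 2 ≤ d x := fun x =>
    poincare_gaussian (fun y => hasDerivAt_dy h1 x y) (by fun_prop) (hasCompactSupport_right hs x)
  have I1 : ∫ x, s x ∂(positionMeasure U) - ∫ x, u x ^ 2 ∂(positionMeasure U) ≤
      ∫ x, d x ∂(positionMeasure U) := by
    rw [← integral_sub si u2i]
    exact integral_mono (si.sub u2i) di poi
  have I2 : ∫ x, v x ^ 2 ∂(positionMeasure U) ≤
      ∫ x, s x ∂(positionMeasure U) - ∫ x, u x ^ 2 ∂(positionMeasure U) := by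
    rw [← integral_sub si u2i]
    refine integral_mono v2i (si.sub u2i) fun x => ?_
    change v x ^ 2 ≤ s x - u x ^ 2
    nlinarith [bes x, sq_nonneg (w x)]
  have qi : Integrable ((Icc (-R₀) R₀).indicator fun x => q x ^ 2) (positionMeasure U) := by
    rw [integrable_indicator_iff measurableSet_Icc]
    exact (qc.pow 2).integrableOn_Icc
  -- Young's inequality with weight `B`, the velocity moments being absorbed by the fibre variance
  -- through Bessel.
  have I3 : B * (2 * ∫ x, q x * w x ∂(positionMeasure U) +
      2 * ∫ x, phi U h x * v x ∂(positionMeasure U)) ≤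
      B ^ 2 * (∫ x, s x ∂(positionMeasure U) - ∫ x, u x ^ 2 ∂(positionMeasure U)) +
      (2 * ∫ x in Icc (-R₀) R₀, q x ^ 2 ∂(positionMeasure U) +
        ∫ x, phi U h x ^ 2 ∂(positionMeasure U)) := by
    rw [← integral_indicator measurableSet_Icc, ← integral_sub si u2i, ← integral_const_mul,
      ← integral_const_mul, ← integral_const_mul, ← integral_const_mul,
      ← integral_add (qwi.const_mul _) (pvi.const_mul _), ← integral_const_mul,
      ← integral_add (qi.const_mul _) pi,
      ← integral_add ((integrable_sub si u2i).const_mul _) ((qi.const_mul _).fun_add pi)]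
    refine integral_mono (((qwi.const_mul _).add (pvi.const_mul _)).const_mul _)
      (((integrable_sub si u2i).const_mul _).add ((qi.const_mul _).add pi)) fun x => ?_
    change B * (2 * (q x * w x) + 2 * (phi U h x * v x)) ≤ B ^ 2 * (s x - u x ^ 2) +
      (2 * (Icc (-R₀) R₀).indicator (fun x => q x ^ 2) x + phi U h x ^ 2)
    have b1 : B ^ 2 * (v x ^ 2 + w x ^ 2 / 2) ≤ B ^ 2 * (s x - u x ^ 2) := by
      gcongr; linarith [bes x]
    have b2 : B * (2 * (q x * w x)) ≤ B ^ 2 * (w x ^ 2 / 2) +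
        2 * (Icc (-R₀) R₀).indicator (fun x => q x ^ 2) x := by
      by_cases hx : x ∈ Icc (-R₀) R₀
      · rw [indicator_of_mem hx]
        nlinarith [sq_nonneg (B * w x - 2 * q x)]
      · rw [indicator_of_notMem hx, hwR x hx]; simp
    nlinarith [sq_nonneg (B * v x - phi U h x)]
  set ir := ∫ x, r x ^ 2 ∂(positionMeasure U) with hir
  have hir0 : 0 ≤ ir := integral_nonneg fun x => sq_nonneg _
  have pb' : ∫ x, phi U h x ^ 2 ∂(positionMeasure U) ≤ ir / c := by
    rw [le_div_iff₀ hc]; linarith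
  -- This is where the value of `B` comes from: `8 = 2 · 4` is the factor in front of the regularity
  -- bound, and `1 / c` bounds `∫ φ²`.
  have I4 : 2 * ∫ x in Icc (-R₀) R₀, q x ^ 2 ∂(positionMeasure U) +
        ∫ x, phi U h x ^ 2 ∂(positionMeasure U) ≤ B * ir := by
    have : (M + 3) * ∫ x, phi U h x ^ 2 ∂(positionMeasure U) ≤ (M + 3) * (ir / c) := by gcongr
    have e : B * ir = 8 * (2 * ir + (M + 3) * (ir / c)) + ir / c := by rw [hB]; field_simp
    rw [e]; linarith
  set X := ∫ x, s x ∂(positionMeasure U) - ∫ x, u x ^ 2 ∂(positionMeasure U) with hX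
  have hX0 : 0 ≤ X := le_trans (integral_nonneg fun x => sq_nonneg (v x)) I2
  have I5 : 2 * ∫ x, q x * w x ∂(positionMeasure U) +
      2 * ∫ x, phi U h x * v x ∂(positionMeasure U) ≤ B * X + ir := by
    refine le_of_mul_le_mul_left ?_ hB0
    linarith
  -- With `X` the microscopic and `ir` the macroscopic variance, the left side is at most `(-2 + 2ε
  -- + εB) X - ε ir`. The condition `ε (3 + B) ≤ 2` makes this at most `-ε (X + ir)`.
  have I6 := mul_le_mul_of_nonneg_left I5 hε.le
  have I7 := mul_le_mul_of_nonneg_left I2 hε.le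
  have I8 := mul_le_mul_of_nonneg_right hεB hX0
  rw [ru]
  have e : ∫ x, s x ∂(positionMeasure U) - m ^ 2 = X + ir := by rw [hX, r2]; ring
  rw [e]
  linarith

end

/-! ### Orbits of a strongly continuous semigroup. -/

section Semigroup

variable {E : Type*} [NormedAddCommGroup E] [NormedSpace ℝ E] {P : ℝ → E →L[ℝ] E}

theorem semigroup_comm (hP : IsC0Semigroup P) {s t : ℝ} (hs : 0 ≤ s) (ht : 0 ≤ t) (f : E) :
    P s (P t f) = P t (P s f) := by
  have h1 := congrArg (fun T : E →L[ℝ] E => T f) (hP.add s t hs ht)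
  have h2 := congrArg (fun T : E →L[ℝ] E => T f) (hP.add t s ht hs)
  rw [add_comm t s] at h2
  exact h1.symm.trans h2

theorem generatorGraph_apply (hP : IsC0Semigroup P) {f g : E} (h : (f, g) ∈ generatorGraph P)
    {t : ℝ} (ht : 0 ≤ t) : (P t f, P t g) ∈ generatorGraph P := by
  change Tendsto (fun s : ℝ => s⁻¹ • (P s (P t f) - P t f)) (𝓝[>] 0) (𝓝 (P t g))
  refine (((P t).continuous.tendsto g).comp h).congr' ?_
  filter_upwards [self_mem_nhdsWithin] with s hs
  rw [semigroup_comm hP (le_of_lt hs) ht]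
  simp

theorem hasDerivWithinAt_right (hP : IsC0Semigroup P) {f g : E} (h : (f, g) ∈ generatorGraph P)
    {t : ℝ} (ht : 0 ≤ t) : HasDerivWithinAt (fun s => P s f) (P t g) (Ici t) t := by
  rw [← hasDerivWithinAt_Ioi_iff_Ici, hasDerivWithinAt_iff_tendsto_slope' self_notMem_Ioi]
  have h1 : Tendsto (fun s : ℝ => s⁻¹ • (P s (P t f) - P t f)) (𝓝[>] 0) (𝓝 (P t g)) :=
    generatorGraph_apply hP h ht
  have h2 : Tendsto (fun s : ℝ => s - t) (𝓝[>] t) (𝓝[>] 0) := by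
    refine tendsto_nhdsWithin_iff.2 ⟨?_, ?_⟩
    · have : Tendsto (fun s : ℝ => s - t) (𝓝 t) (𝓝 (t - t)) := (continuous_sub_right t).tendsto t
      rw [sub_self] at this
      exact this.mono_left nhdsWithin_le_nhds
    · filter_upwards [self_mem_nhdsWithin] with s hs
      exact sub_pos.2 (mem_Ioi.1 hs)
  refine (h1.comp h2).congr' ?_
  filter_upwards [self_mem_nhdsWithin] with s hs
  have := congrArg (fun T : E →L[ℝ] E => T f) (hP.add (s - t) t (sub_nonneg.2 (le_of_lt hs)) ht)
  simp only [sub_add_cancel, ContinuousLinearMap.comp_apply] at this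
  simp only [Function.comp, slope, vsub_eq_sub, this]

theorem apply_eq_zero_of_const (hP : IsC0Semigroup P) {f g k : E}
    (h : (f, g) ∈ generatorGraph P) {t : ℝ} (ht : 0 ≤ t) (hc : ∀ s, t ≤ s → P s f = k) :
    ∀ s, t ≤ s → P s g = 0 := by
  intro s hs
  have h1 := hasDerivWithinAt_right hP h (ht.trans hs)
  have h2 : HasDerivWithinAt (fun r => P r f) 0 (Ici s) s :=
    (hasDerivWithinAt_const s (Ici s) k).congr (fun r hr => hc r (hs.trans hr)) (hc s hs)
  exact (uniqueDiffWithinAt_Ici s).eq_deriv _ h1 h2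

variable [CompleteSpace E]

/-- The semigroup law gives only the right derivative directly. The orbit minus the primitive of the
continuous function `P_t g` has zero right derivative, hence is constant, and this supplies the left
derivative. The truncation `max s 0` keeps the integrand continuous on the whole line. -/
theorem hasDerivWithinAt_semigroup (hP : IsC0Semigroup P) {f g : E}
    (h : (f, g) ∈ generatorGraph P) {t : ℝ} (ht : 0 ≤ t) :
    HasDerivWithinAt (fun s => P s f) (P t g) (Ici 0) t := by
  set k : ℝ → E := fun s => P (max s 0) g with hk
  have kc : Continuous k :=
    (hP.cont g).comp_continuous (by fun_prop) fun s => le_max_right s 0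
  have kd : ∀ s, HasDerivAt (fun s => ∫ r in (0 : ℝ)..s, k r) (k s) s := fun s =>
    intervalIntegral.integral_hasDerivAt_right (kc.intervalIntegrable _ _)
      (kc.stronglyMeasurableAtFilter _ _) kc.continuousAt
  have hkt : ∀ s, 0 ≤ s → k s = P s g := fun s hs => by simp only [hk, max_eq_left hs]
  have hf : ∀ s, 0 ≤ s → P s f = P 0 f + ∫ r in (0 : ℝ)..s, k r := by
    intro s hs
    have := constant_of_has_deriv_right_zero (f := fun s => P s f - ∫ r in (0 : ℝ)..s, k r)
      (a := 0) (b := s)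
      (((hP.cont f).mono Icc_subset_Ici_self).sub
        (fun r _ => (kd r).continuousAt.continuousWithinAt))
      (fun r hr => by
        have := (hasDerivWithinAt_right hP h hr.1).sub (kd r).hasDerivWithinAt
        rw [hkt r hr.1, sub_self] at this
        exact this) s (right_mem_Icc.2 hs)
    simp only [intervalIntegral.integral_same, sub_zero] at this
    rw [← this]; abel
  have := ((kd t).const_add (P 0 f)).hasDerivWithinAt (s := Ici 0)
  rw [hkt t ht] at this
  exact this.congr (fun s hs => hf s hs) (hf t ht)

/-- Stability of `D` makes the derivative of an orbit another orbit starting in `D`. -/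
theorem contDiffOn_semigroup (hP : IsC0Semigroup P) {D : Set E}
    (hD : ∀ f ∈ D, ∃ g ∈ D, (f, g) ∈ generatorGraph P) (n : ℕ) :
    ∀ f ∈ D, ContDiffOn ℝ n (fun t => P t f) (Ici 0) := by
  induction n with
  | zero => intro f _; exact contDiffOn_zero.2 (hP.cont f)
  | succ n ih =>
    intro f hf
    obtain ⟨g, hg, hfg⟩ := hD f hf
    push_cast
    rw [contDiffOn_succ_iff_derivWithin (uniqueDiffOn_Ici 0)]
    refine ⟨fun t ht => (hasDerivWithinAt_semigroup hP hfg ht).differentiableWithinAt,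
      fun h => by simp at h, (ih g hg).congr fun t ht => ?_⟩
    exact (hasDerivWithinAt_semigroup hP hfg ht).derivWithin (uniqueDiffOn_Ici 0 t ht)

end Semigroup

/-! ### Abstract hypocoercivity, the third-order inequality and the decay rate. -/

section Energy

variable {E : Type*} [NormedAddCommGroup E] [InnerProductSpace ℝ E]

/-- The squared norm of the component orthogonal to `e`, for a unit vector `e`. -/
noncomputable def centredEnergy (e h : E) : ℝ := ‖h‖ ^ 2 - (inner ℝ e h : ℝ) ^ 2

/-- The energy modified by a correction operator. -/
noncomputable def modifiedEnergy (e : E) (A : E →L[ℝ] E) (ε : ℝ) (h : E) : ℝ :=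
  centredEnergy e h - 2 * ε * inner ℝ (A h) h

/-- Hypocoercivity of a semigroup in terms of a modified energy. -/
structure IsHypocoercive (P : ℝ → E →L[ℝ] E) (e : E) (A : E →L[ℝ] E) (ε : ℝ) : Prop where
  semigroup : IsC0Semigroup P
  pos : 0 < ε
  norm_eq : ‖e‖ = 1
  inner_eq : ∀ h g, (h, g) ∈ generatorGraph P → inner ℝ e g = (0 : ℝ)
  correction : ∀ h, |2 * ε * inner ℝ (A h) h| ≤ 1 / 2 * centredEnergy e h
  dissipation : ∀ h g, (h, g) ∈ generatorGraph P →
    2 * inner ℝ h g - 2 * ε * (inner ℝ (A g) h + inner ℝ (A h) g) ≤ -ε * centredEnergy e h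

namespace IsHypocoercive

variable {P : ℝ → E →L[ℝ] E} {e : E} {A : E →L[ℝ] E} {ε : ℝ}

theorem le_modifiedEnergy (H : IsHypocoercive P e A ε) (h : E) :
    centredEnergy e h ≤ 2 * modifiedEnergy e A ε h := by
  have := (abs_le.1 (H.correction h)).2
  unfold modifiedEnergy; linarith

theorem modifiedEnergy_le (H : IsHypocoercive P e A ε) (h : E) :
    modifiedEnergy e A ε h ≤ 3 / 2 * centredEnergy e h := by
  have := (abs_le.1 (H.correction h)).1
  unfold modifiedEnergy; linarith

theorem centredEnergy_eq (H : IsHypocoercive P e A ε) (h : E) :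
    centredEnergy e h = ‖h - (inner ℝ e h : ℝ) • e‖ ^ 2 :=
  (norm_sub_inner_smul_sq H.norm_eq h).symm

theorem modifiedEnergy_nonneg (H : IsHypocoercive P e A ε) (h : E) :
    0 ≤ modifiedEnergy e A ε h := by
  have := H.le_modifiedEnergy h
  rw [H.centredEnergy_eq] at this
  nlinarith [sq_nonneg ‖h - (inner ℝ e h : ℝ) • e‖]

variable [CompleteSpace E]

/-- Dissipation controls the centred energy, which is at least `2/3` of the modified one; hence the
rate `2ε/3`. -/
theorem exists_hasDerivWithinAt (H : IsHypocoercive P e A ε) {f g : E}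
    (h : (f, g) ∈ generatorGraph P) {t : ℝ} (ht : 0 ≤ t) :
    ∃ q, HasDerivWithinAt (fun s => modifiedEnergy e A ε (P s f)) q (Ici 0) t ∧
      q ≤ -(2 * ε / 3) * modifiedEnergy e A ε (P t f) := by
  have hd := hasDerivWithinAt_semigroup H.semigroup h ht
  have hg := generatorGraph_apply H.semigroup h ht
  have hA : HasDerivWithinAt (fun s => A (P s f)) (A (P t g)) (Ici 0) t :=
    A.hasFDerivAt.comp_hasDerivWithinAt t hd
  have h1 := hd.norm_sq
  have h2 := ((hasDerivWithinAt_const t (Ici 0) e).inner ℝ hd).fun_pow 2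
  have h3 := (hA.inner ℝ hd).const_mul (2 * ε)
  refine ⟨_, (h1.fun_sub h2).fun_sub h3, ?_⟩
  have := H.dissipation _ _ hg
  have h4 := H.modifiedEnergy_le (P t f)
  have h5 := mul_le_mul_of_nonneg_left h4 H.pos.le
  simp only [H.inner_eq _ _ hg, inner_zero_left]
  linarith

theorem modifiedEnergy_decay (H : IsHypocoercive P e A ε) {f g : E}
    (h : (f, g) ∈ generatorGraph P) {s t : ℝ} (hs : 0 ≤ s) (hst : s ≤ t) :
    Real.exp (2 * ε / 3 * t) * modifiedEnergy e A ε (P t f) ≤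
      Real.exp (2 * ε / 3 * s) * modifiedEnergy e A ε (P s f) := by
  choose! q hq hle using fun t (ht : 0 ≤ t) => H.exists_hasDerivWithinAt h ht
  set W : ℝ → ℝ := fun t => Real.exp (2 * ε / 3 * t) * modifiedEnergy e A ε (P t f) with hW
  have hexp : ∀ t, HasDerivAt (fun t => Real.exp (2 * ε / 3 * t))
      (Real.exp (2 * ε / 3 * t) * (2 * ε / 3)) t := fun t => by
    simpa using ((hasDerivAt_id t).const_mul (2 * ε / 3)).exp
  have hd : ∀ t, 0 ≤ t → HasDerivWithinAt W (Real.exp (2 * ε / 3 * t) * (2 * ε / 3) *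
      modifiedEnergy e A ε (P t f) + Real.exp (2 * ε / 3 * t) * q t) (Ici 0) t := fun t ht =>
    (hexp t).hasDerivWithinAt.fun_mul (hq t ht)
  refine antitoneOn_of_deriv_nonpos (convex_Ici 0)
    (fun t ht => (hd t ht).continuousWithinAt) (fun t ht => ?_) (fun t ht => ?_) hs
    (hs.trans hst) hst
  · rw [interior_Ici] at ht ⊢
    exact ((hd t (le_of_lt ht)).mono Ioi_subset_Ici_self).differentiableWithinAt
  · rw [interior_Ici] at ht
    rw [((hd t (le_of_lt ht)).hasDerivAt (Ici_mem_nhds ht)).deriv]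
    have := mul_le_mul_of_nonneg_left (hle t (le_of_lt ht)) (Real.exp_pos (2 * ε / 3 * t)).le
    linarith

/-- Conservation of mass: centring by the initial mean is the same as centring by the current one.
-/
theorem inner_apply_eq (H : IsHypocoercive P e A ε) {f g : E}
    (h : (f, g) ∈ generatorGraph P) {t : ℝ} (ht : 0 ≤ t) :
    inner ℝ e (P t f) = (inner ℝ e f : ℝ) := by
  have h0 : P 0 f = f := by rw [H.semigroup.zero]; rfl
  have hd : ∀ s, 0 ≤ s → HasDerivWithinAt (fun s => (inner ℝ e (P s f) : ℝ)) 0 (Ici 0) s := by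
    intro s hs
    have := (hasDerivWithinAt_const s (Ici 0) e).inner ℝ (hasDerivWithinAt_semigroup H.semigroup h hs)
    rw [H.inner_eq _ _ (generatorGraph_apply H.semigroup h hs)] at this
    simpa using this
  have := constant_of_has_deriv_right_zero (f := fun s => (inner ℝ e (P s f) : ℝ)) (a := 0) (b := t)
    (fun s hs => ((hd s hs.1).continuousWithinAt).mono Icc_subset_Ici_self)
    (fun s hs => (hd s hs.1).mono (Ici_subset_Ici.2 hs.1)) t (right_mem_Icc.2 ht)
  simpa [h0] using this

theorem centredEnergy_apply (H : IsHypocoercive P e A ε) {f g : E}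
    (h : (f, g) ∈ generatorGraph P) {t : ℝ} (ht : 0 ≤ t) :
    centredEnergy e (P t f) = ‖P t f - (inner ℝ e f : ℝ) • e‖ ^ 2 := by
  rw [H.centredEnergy_eq, H.inner_apply_eq h ht]

/-- The modified energy is nonnegative and decaying, so once zero it stays zero. -/
theorem apply_const_of_centredEnergy_eq_zero (H : IsHypocoercive P e A ε) {f g : E}
    (h : (f, g) ∈ generatorGraph P) {t : ℝ} (ht : 0 ≤ t)
    (h0 : centredEnergy e (P t f) = 0) :
    ∀ s, t ≤ s → P s f = (inner ℝ e f : ℝ) • e := by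
  intro s hs
  have h1 := H.modifiedEnergy_decay h ht hs
  have h2 := H.modifiedEnergy_le (P t f)
  have h3 := H.le_modifiedEnergy (P s f)
  rw [h0, mul_zero] at h2
  have h4 : modifiedEnergy e A ε (P s f) ≤ 0 := by
    have : Real.exp (2 * ε / 3 * s) * modifiedEnergy e A ε (P s f) ≤ 0 :=
      h1.trans (mul_nonpos_of_nonneg_of_nonpos (Real.exp_pos _).le h2)
    exact nonpos_of_mul_nonpos_right this (Real.exp_pos _)
  rw [H.centredEnergy_apply h (ht.trans hs)] at h3
  have : ‖P s f - (inner ℝ e f : ℝ) • e‖ = 0 := by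
    have : ‖P s f - (inner ℝ e f : ℝ) • e‖ ^ 2 = 0 := le_antisymm (by linarith) (sq_nonneg _)
    simpa using this
  exact sub_eq_zero.1 (norm_eq_zero.1 this)

/-- The third order differential inequality. The function `ν` is chosen so that
`[(∂ₜ + η)² + νₜ] Φ` is a multiple of the sum of the modified energies of `P_t f`, `P_t L f` and
`P_t L² f`, which dominates `(∂ₜ + η)² Φ` and decays exponentially. -/
theorem exists_third_order (H : IsHypocoercive P e A ε) {D : Set E}
    (hD : ∀ f ∈ D, ∃ g ∈ D, (f, g) ∈ generatorGraph P) {f : E} (hf : f ∈ D) {Φ : ℝ → ℝ}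
    (hΦ : ∀ t, Φ t = ‖P t f - (inner ℝ e f : ℝ) • e‖ ^ 2) {η lam : ℝ} (hη : 0 ≤ η)
    (hlam : lam ≤ 2 * ε / 3) :
    ∃ ν : ℝ → ℝ, (∀ t, 0 ≤ t → 0 ≤ ν t) ∧ ContDiffOn ℝ 3 Φ (Ici 0) ∧
      DifferentiableOn ℝ (fun t => dPlus η (dPlus η Φ) t + ν t * Φ t) (Ici 0) ∧
      ∀ t, 0 ≤ t → dPlus lam (fun t => dPlus η (dPlus η Φ) t + ν t * Φ t) t ≤ 0 := by
  obtain ⟨g₁, hg₁, h₁⟩ := hD f hf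
  obtain ⟨g₂, hg₂, h₂⟩ := hD g₁ hg₁
  obtain ⟨g₃, hg₃, h₃⟩ := hD g₂ hg₂
  set k : ℝ → E := fun t => P t f - (inner ℝ e f : ℝ) • e with hk
  have hΦ' : Φ = fun t => ‖k t‖ ^ 2 := funext hΦ
  have d0 : ∀ t, 0 ≤ t → HasDerivWithinAt k (P t g₁) (Ici 0) t := fun t ht =>
    (hasDerivWithinAt_semigroup H.semigroup h₁ ht).sub_const _
  have d1 : ∀ t, 0 ≤ t → HasDerivWithinAt (fun t => P t g₁) (P t g₂) (Ici 0) t := fun t ht =>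
    hasDerivWithinAt_semigroup H.semigroup h₂ ht
  have hu : ∀ t : ℝ, 0 ≤ t → UniqueDiffWithinAt ℝ (Ici 0) t := fun t ht => uniqueDiffOn_Ici 0 t ht
  have D0 : ∀ t, 0 ≤ t → HasDerivWithinAt Φ (2 * inner ℝ (k t) (P t g₁)) (Ici 0) t := by
    intro t ht; rw [hΦ']; exact (d0 t ht).norm_sq
  have e1 : ∀ t, 0 ≤ t → dPlus η Φ t = 2 * inner ℝ (k t) (P t g₁) + η * Φ t := fun t ht => by
    rw [dPlus, (D0 t ht).derivWithin (hu t ht)]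
  have D1 : ∀ t, 0 ≤ t → HasDerivWithinAt (dPlus η Φ)
      (2 * (inner ℝ (k t) (P t g₂) + inner ℝ (P t g₁) (P t g₁)) +
        η * (2 * inner ℝ (k t) (P t g₁))) (Ici 0) t := fun t ht =>
    ((((d0 t ht).inner ℝ (d1 t ht)).const_mul 2).add ((D0 t ht).const_mul η)).congr
      (fun s hs => e1 s hs) (e1 t ht)
  have e2 : ∀ t, 0 ≤ t → dPlus η (dPlus η Φ) t =
      2 * inner ℝ (k t) (P t g₂) + 2 * ‖P t g₁‖ ^ 2 + 4 * η * inner ℝ (k t) (P t g₁) +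
        η ^ 2 * ‖k t‖ ^ 2 := fun t ht => by
    rw [dPlus, (D1 t ht).derivWithin (hu t ht), e1 t ht, real_inner_self_eq_norm_sq, hΦ t]; ring
  -- Young's inequality bounds every coefficient in `e2` by `2 + 2η + η²`. The outer `2` converts
  -- centred into modified energies.
  set C : ℝ := 2 * (2 + 2 * η + η ^ 2) with hC
  have hC0 : 0 ≤ C := by positivity
  set G : ℝ → ℝ := fun t => C * (modifiedEnergy e A ε (P t f) + modifiedEnergy e A ε (P t g₁) +
    modifiedEnergy e A ε (P t g₂)) with hG
  have hG0 : ∀ t, 0 ≤ G t := fun t => by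
    have a := H.modifiedEnergy_nonneg (P t f)
    have b := H.modifiedEnergy_nonneg (P t g₁)
    have c := H.modifiedEnergy_nonneg (P t g₂)
    simp only [hG]; positivity
  have c0 : ∀ t, 0 ≤ t → centredEnergy e (P t f) = ‖k t‖ ^ 2 := fun t ht =>
    H.centredEnergy_apply h₁ ht
  have c1 : ∀ t, 0 ≤ t → centredEnergy e (P t g₁) = ‖P t g₁‖ ^ 2 := fun t ht => by
    rw [H.centredEnergy_apply h₂ ht, H.inner_eq _ _ h₁]; simp
  have c2 : ∀ t, 0 ≤ t → centredEnergy e (P t g₂) = ‖P t g₂‖ ^ 2 := fun t ht => by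
    rw [H.centredEnergy_apply h₃ ht, H.inner_eq _ _ h₂]; simp
  have hdom : ∀ t, 0 ≤ t → dPlus η (dPlus η Φ) t ≤ G t := by
    intro t ht
    have q0 := H.le_modifiedEnergy (P t f)
    have q1 := H.le_modifiedEnergy (P t g₁)
    have q2 := H.le_modifiedEnergy (P t g₂)
    rw [c0 t ht] at q0; rw [c1 t ht] at q1; rw [c2 t ht] at q2
    have i2 := real_inner_le_norm (k t) (P t g₂)
    have i1 := real_inner_le_norm (k t) (P t g₁)
    have y2 : 2 * inner ℝ (k t) (P t g₂) ≤ ‖k t‖ ^ 2 + ‖P t g₂‖ ^ 2 := by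
      nlinarith [sq_nonneg (‖k t‖ - ‖P t g₂‖)]
    have y1 : 2 * inner ℝ (k t) (P t g₁) ≤ ‖k t‖ ^ 2 + ‖P t g₁‖ ^ 2 := by
      nlinarith [sq_nonneg (‖k t‖ - ‖P t g₁‖)]
    have y1' := mul_le_mul_of_nonneg_left y1 hη
    have s : (2 + 2 * η + η ^ 2) * (‖k t‖ ^ 2 + ‖P t g₁‖ ^ 2 + ‖P t g₂‖ ^ 2) ≤ G t := by
      simp only [hG, hC]
      rw [mul_comm 2 (2 + 2 * η + η ^ 2), mul_assoc]
      gcongr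
      linarith
    rw [e2 t ht]
    have p1 : 0 ≤ η * ‖P t g₂‖ ^ 2 := by positivity
    have p2 : 0 ≤ η ^ 2 * ‖P t g₂‖ ^ 2 := by positivity
    have p3 : 0 ≤ η ^ 2 * ‖P t g₁‖ ^ 2 := by positivity
    nlinarith [sq_nonneg ‖k t‖, sq_nonneg ‖P t g₂‖, sq_nonneg ‖P t g₁‖]
  -- Where `Φ` vanishes, no `ν` can correct a mismatch. There the orbit is at equilibrium from `t`
  -- on, so `P_t g₁` and `P_t g₂` vanish as well and both sides are `0`.
  have hzero : ∀ t, 0 ≤ t → Φ t = 0 → dPlus η (dPlus η Φ) t = G t := by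
    intro t ht h0
    rw [hΦ t, ← H.centredEnergy_apply h₁ ht] at h0
    have z0 := H.apply_const_of_centredEnergy_eq_zero h₁ ht h0
    have z1 := apply_eq_zero_of_const H.semigroup h₁ ht z0
    have z2 := apply_eq_zero_of_const H.semigroup h₂ ht z1
    have kz : k t = 0 := by simp only [hk, z0 t le_rfl, sub_self]
    have m0 : modifiedEnergy e A ε (P t f) = 0 := by
      refine le_antisymm ?_ (H.modifiedEnergy_nonneg _)
      have := H.modifiedEnergy_le (P t f)
      rwa [h0, mul_zero] at this
    have m1 : modifiedEnergy e A ε (0 : E) = 0 := by simp [modifiedEnergy, centredEnergy]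
    simp only [e2 t ht, hG, m0, m1, kz, z1 t le_rfl, z2 t le_rfl]
    simp
  refine ⟨fun t => if Φ t = 0 then 0 else (G t - dPlus η (dPlus η Φ) t) / Φ t, fun t ht => ?_, ?_,
    ?_⟩
  · dsimp only
    split_ifs
    · exact le_rfl
    · exact div_nonneg (sub_nonneg.2 (hdom t ht)) (by rw [hΦ t]; positivity)
  · rw [hΦ']
    exact ((contDiffOn_semigroup H.semigroup hD 3 f hf).sub contDiffOn_const).norm_sq ℝ
  have hGe : ∀ t ∈ Ici (0 : ℝ), dPlus η (dPlus η Φ) t +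
      (if Φ t = 0 then 0 else (G t - dPlus η (dPlus η Φ) t) / Φ t) * Φ t = G t := by
    intro t ht
    split_ifs with h0
    · rw [zero_mul, add_zero, hzero t ht h0]
    · field_simp; ring
  have hGd : ∀ t, 0 ≤ t → ∃ q, HasDerivWithinAt G q (Ici 0) t ∧ q ≤ -(2 * ε / 3) * G t := by
    intro t ht
    obtain ⟨q0, a0, b0⟩ := H.exists_hasDerivWithinAt h₁ ht
    obtain ⟨q1, a1, b1⟩ := H.exists_hasDerivWithinAt h₂ ht
    obtain ⟨q2, a2, b2⟩ := H.exists_hasDerivWithinAt h₃ ht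
    refine ⟨_, ((a0.add a1).add a2).const_mul C, ?_⟩
    have := mul_le_mul_of_nonneg_left (add_le_add (add_le_add b0 b1) b2) hC0
    refine this.trans_eq ?_
    simp only [hG]; ring
  refine ⟨fun t ht => ?_, fun t ht => ?_⟩
  · obtain ⟨q, hq, _⟩ := hGd t ht
    exact (hq.congr hGe (hGe t ht)).differentiableWithinAt
  · obtain ⟨q, hq, hle⟩ := hGd t ht
    rw [dPlus, (hq.congr hGe (hGe t ht)).derivWithin (hu t ht), hGe t ht]
    have := mul_le_mul_of_nonneg_right hlam (hG0 t)
    linarith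

/-- The exponential decay rate. -/
theorem limsup_le (H : IsHypocoercive P e A ε) {f g : E} (h : (f, g) ∈ generatorGraph P)
    {Φ : ℝ → ℝ} (hΦ : ∀ t, Φ t = ‖P t f - (inner ℝ e f : ℝ) • e‖ ^ 2) {lam : ℝ}
    (hlam : lam < 2 * ε / 3) :
    limsup (fun t : ℝ => ((1 / t : ℝ) : EReal) * ENNReal.log (ENNReal.ofReal (Φ t))) atTop ≤
      ((-lam : ℝ) : EReal) := by
  set κ := 2 * ε / 3 with hκ
  set B := modifiedEnergy e A ε (P 0 f) with hB
  -- The strict gap `lam < κ` absorbs the prefactor `2B`, so `Φ ≤ exp (-lam t)` holds eventually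
  -- with constant `1`.
  have hlim : Tendsto (fun t => Real.exp (-((κ - lam) * t)) * (2 * B)) atTop (𝓝 (0 * (2 * B))) := by
    refine (Real.tendsto_exp_atBot.comp ?_).mul_const _
    exact tendsto_neg_atTop_atBot.comp (tendsto_id.const_mul_atTop (sub_pos.2 hlam))
  rw [zero_mul] at hlim
  refine limsup_le_of_le (h := ?_)
  filter_upwards [eventually_gt_atTop 0, hlim.eventually (gt_mem_nhds one_pos)] with t ht hlt
  have h1 := H.modifiedEnergy_decay h le_rfl ht.le
  rw [mul_zero, Real.exp_zero, one_mul, ← hB, ← hκ] at h1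
  have h2 := H.le_modifiedEnergy (P t f)
  rw [H.centredEnergy_apply h ht.le, ← hΦ t] at h2
  have hF : Φ t ≤ Real.exp (-(lam * t)) := by
    have e1 : Real.exp (-((κ - lam) * t)) = Real.exp (lam * t) * (Real.exp (κ * t))⁻¹ := by
      rw [← Real.exp_neg, ← Real.exp_add]; ring_nf
    rw [e1] at hlt
    have p1 := Real.exp_pos (κ * t)
    have p2 := Real.exp_pos (lam * t)
    have h3 : modifiedEnergy e A ε (P t f) ≤ (Real.exp (κ * t))⁻¹ * B := by
      rw [inv_mul_eq_div, le_div_iff₀ p1]; linarith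
    rw [Real.exp_neg, ← one_div, le_div_iff₀ p2]
    calc Φ t * Real.exp (lam * t) ≤ (2 * ((Real.exp (κ * t))⁻¹ * B)) * Real.exp (lam * t) := by
          gcongr; linarith
      _ ≤ 1 := by linarith
  calc ((1 / t : ℝ) : EReal) * ENNReal.log (ENNReal.ofReal (Φ t))
      ≤ ((1 / t : ℝ) : EReal) * ENNReal.log (ENNReal.ofReal (Real.exp (-(lam * t)))) := by
        refine mul_le_mul_of_nonneg_left ?_ (by exact_mod_cast (by positivity : (0 : ℝ) ≤ 1 / t))
        exact ENNReal.log_monotone (ENNReal.ofReal_le_ofReal hF)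
    _ = ((-lam : ℝ) : EReal) := by
        rw [ENNReal.log_ofReal_of_pos (Real.exp_pos _), Real.log_exp, ← EReal.coe_mul]
        congr 1
        field_simp

end IsHypocoercive

end Energy

/-! ### The kinetic Fokker–Planck semigroup and the choice of constants. -/

theorem isHypocoercive {U : ℝ → ℝ} (hU : ContDiff ℝ ∞ U)
    (hI : Integrable fun x => Real.exp (-U x)) [IsProbabilityMeasure (positionMeasure U)]
    {c M : ℝ} (hc : 0 < c) (hP : Poincare (positionMeasure U) c)
    (hM : ∀ x, |iteratedDeriv 2 U x| ≤ M) {B ε : ℝ} (hB : B = 8 * (2 + (M + 3) / c) + 1 / c)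
    (hε : 0 < ε) (hεB : ε * (3 + B) ≤ 2) (hεc : 2 * ε * Real.sqrt c⁻¹ ≤ 1 / 2)
    {P : ℝ → L2 U →L[ℝ] L2 U} (hS : IsSemigroup U P) :
    ∃ A : L2 U →L[ℝ] L2 U, IsHypocoercive P (one U) A ε := by
  obtain ⟨A, hA⟩ := exists_correction hU.continuous hI hc hP
  refine ⟨A, hS.semigroup, hε, norm_one U, ?_, ?_, ?_⟩
  · rw [hS.generator]
    have hcl : IsClosed {p : L2 U × L2 U | inner ℝ (one U) p.2 = (0 : ℝ)} :=
      isClosed_eq (by fun_prop) continuous_const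
    intro h g hg
    refine closure_minimal ?_ hcl hg
    rintro p ⟨φ, hφ, hs, -, h2⟩
    rw [mem_ofPred_eq, inner_eq_integral (coeFn_one U) h2]
    simpa using integral_diffOp hU hφ hs
  · intro h
    have h1 := correction_bounds hU.continuous hI hc hP hA h
    rw [norm_sub_inner_smul_sq (norm_one U)] at h1
    have h0 : 0 ≤ centredEnergy (one U) h := by
      unfold centredEnergy
      rw [← norm_sub_inner_smul_sq (norm_one U)]; positivity
    rw [abs_mul, abs_of_pos (by positivity : 0 < 2 * ε)]
    calc 2 * ε * |inner ℝ (A h) h| ≤ 2 * ε * (Real.sqrt c⁻¹ * centredEnergy (one U) h) := by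
          gcongr; exact h1
      _ = (2 * ε * Real.sqrt c⁻¹) * centredEnergy (one U) h := by ring
      _ ≤ 1 / 2 * centredEnergy (one U) h := by gcongr
  · rw [hS.generator]
    -- Both sides are continuous in the pair `(h, g)` because `A` is bounded, so the inequality
    -- passes from test functions to the closure of their graph.
    have hcl : IsClosed {p : L2 U × L2 U | 2 * inner ℝ p.1 p.2 -
        2 * ε * (inner ℝ (A p.2) p.1 + inner ℝ (A p.1) p.2) ≤ -ε * centredEnergy (one U) p.1} := by
      unfold centredEnergy
      exact isClosed_le (by fun_prop) (by fun_prop)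
    intro h g hg
    refine closure_minimal ?_ hcl hg
    rintro ⟨h, g⟩ ⟨φ, hφ, hs, h1, h2⟩
    simp only at h1 h2
    have hA1 : A h =ᵐ[gibbs U] fun z => phi U φ z.1 * z.2 := by rw [← phi_congr U h1]; exact hA h
    have hA2 : A g =ᵐ[gibbs U] fun z => phi U (diffOp U φ) z.1 * z.2 := by
      rw [← phi_congr U h2]; exact hA g
    have key := dissipation hU hI hc hP hM hφ hs hB hε hεB
    rw [mem_ofPred_eq, centredEnergy, ← real_inner_self_eq_norm_sq, inner_eq_integral h1 h2,
      inner_eq_integral hA2 h1, inner_eq_integral hA1 h2, inner_eq_integral h1 h1,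
      inner_eq_integral (coeFn_one U) h1]
    simpa [← pow_two] using key

theorem rootRate_zero (η : ℝ) : rootRate η 0 = η := by
  simp [rootRate, Complex.sqrt]

end KFP

theorem mainTheorem2 (c M : ℝ) (hc : 0 < c) :
    ∃ lam η νs : ℝ, 0 < lam ∧ 0 < η ∧ 0 < KFP.rootRate η νs ∧
      ∀ U : ℝ → ℝ, ContDiff ℝ ∞ U → (∀ x, |iteratedDeriv 2 U x| ≤ M) →
        Integrable (fun x => Real.exp (-U x)) → KFP.Poincare (KFP.positionMeasure U) c →
      ∀ P : ℝ → KFP.L2 U →L[ℝ] KFP.L2 U, KFP.IsSemigroup U P →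
      ∀ D : Set (KFP.L2 U), (∀ f ∈ D, ∃ g ∈ D, (f, g) ∈ KFP.generatorGraph P) →
      ∀ f ∈ D,
        (∃ ν : ℝ → ℝ, (∀ t, 0 ≤ t → νs ≤ ν t) ∧
          ContDiffOn ℝ 3 (KFP.F U P f) (Ici 0) ∧
          DifferentiableOn ℝ
            (fun t => KFP.dPlus η (KFP.dPlus η (KFP.F U P f)) t + ν t * KFP.F U P f t) (Ici 0) ∧
          ∀ t, 0 ≤ t →
            KFP.dPlus lam
              (fun t => KFP.dPlus η (KFP.dPlus η (KFP.F U P f)) t + ν t * KFP.F U P f t) t ≤ 0) ∧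
        limsup (fun t : ℝ => ((1 / t : ℝ) : EReal) * ENNReal.log (ENNReal.ofReal (KFP.F U P f t)))
          atTop ≤ ((-min lam (KFP.rootRate η νs) : ℝ) : EReal) := by
  -- The constants are fixed before any `U` is given, so `M` may be negative; the absolute value
  -- keeps `B` positive.
  set N := |M| with hN
  set B := 8 * (2 + (N + 3) / c) + 1 / c with hB
  have hB0 : 0 < B := by positivity
  set ε := min (2 / (3 + B)) (1 / (4 * (Real.sqrt c⁻¹ + 1))) with hε
  have hε0 : 0 < ε := by positivity
  have hεB : ε * (3 + B) ≤ 2 := by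
    rw [← le_div_iff₀ (by positivity)]; exact min_le_left _ _
  have hεc : 2 * ε * Real.sqrt c⁻¹ ≤ 1 / 2 := by
    have h1 : ε * (4 * (Real.sqrt c⁻¹ + 1)) ≤ 1 := by
      rw [← le_div_iff₀ (by positivity)]; exact min_le_right _ _
    nlinarith
  -- Taking `λ = η = ε / 3` and `ν_* = 0` makes the minimum in the limsup bound equal to `ε / 3`,
  -- strictly below the true decay rate `2ε / 3`.
  refine ⟨ε / 3, ε / 3, 0, by positivity, by positivity, by rw [KFP.rootRate_zero]; positivity,
    fun U hU hM hI hP P hS D hD f hf => ?_⟩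
  have : IsProbabilityMeasure (KFP.positionMeasure U) := isProbabilityMeasure_tilted hI
  obtain ⟨A, H⟩ := KFP.isHypocoercive hU hI hc hP (fun x => (hM x).trans (le_abs_self M)) hB hε0
    hεB hεc hS
  have hΦ : ∀ t, KFP.F U P f t =
      ‖P t f - (inner ℝ (KFP.one U) f : ℝ) • KFP.one U‖ ^ 2 := fun t => by
    rw [KFP.inner_one, ← KFP.integral_sub_sq]; rfl
  obtain ⟨g, -, hfg⟩ := hD f hf
  refine ⟨H.exists_third_order hD hf hΦ (by positivity) (by linarith), ?_⟩
  rw [KFP.rootRate_zero, min_self]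
  exact H.limsup_le hfg hΦ (by linarith)
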